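/- Let $\Bbbk$ be a field and $f:C\to D$ a morphism of (coassociative, counital) $\Bbbk$-coalgebras. Write $\mathcal M^C$, ${}^C\mathcal M$, ${}^C\mathcal M^C$ for the categories of right comodules, left comodules and bicomodules over $C$, and $V\square_D W\subseteq V\otimes W$ for the cotensor product, i.e. the equalizer of $\rho_V\otimes\mathrm{id}$ and $\mathrm{id}\otimes\lambda_W$ for a right $D$-coaction $\rho_V$ and a left $D$-coaction $\lambda_W$. Through $f$, $C$ is a $D$-bicomodule and every $C$-comodule is a $D$-comodule. The cotensor product $C\square_D C$ is a unital algebra in the monoidal category $({}^C\mathcal M^C,\square_C,C)$, with multiplication $$(C\square_DC)\square_C(C\square_DC)\cong C\square_DC\square_DC\xrightarrow{\ \mathrm{id}\otimes\varepsilon_C\otimes\mathrm{id}\ }C\square_DC$$ and unit $\Delta_C:C\to C\square_DC$. Let $\mathcal M_{C\square_DC}$ be the category of right $C\square_DC$-modules: right $C$-comodules $N$ with an associative and unital action $N\square_C(C\square_DC)\to N$ in $\mathcal M^C$. For $W\in\mathcal M^D$, the right $C$-comodule $W\square_DC$ is such a module through $$(W\square_DC)\square_C(C\square_DC)\cong W\square_DC\square_DC\xrightarrow{\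 \mathrm{id}\otimes\varepsilon_C\otimes\mathrm{id}\ }W\square_DC .$$ The resulting functor $-\square_DC:\mathcal M^D\to\mathcal M_{C\square_DC}$ has as left adjoint the functor of coinvariants $N\mapsto N_{C\square_DC}$, where $N_{C\square_DC}$ is the coequalizer in vector spaces, with the induced right $D$-coaction, of the two maps $N\square_DC\to N$ given by the action (along $N\square_DC\cong N\square_C(C\square_DC)$) and by $\mathrm{id}\otimes\varepsilon_C$. The unit of the adjunction is $N\to N_{C\square_DC}\square_DC$, $n\mapsto [n_0]\otimes n_1$, and its counit is $(W\square_DC)_{C\square_DC}\to W$, $[w\otimes c]\mapsto \varepsilon_C(c)w$. **Theorem.** This adjunction is an equivalence of categories (its unit and its counit are isomorphisms) if at least one of the following holds: - $f$ is left faithfully coflat: the functor $-\square_DC:\mathcal M^D\to\mathrm{Vec}_{\Bbbk}$ is exact and faithful; - $f$ has a right inverse in the category ${}^D\mathcal M^D$ of $D$-bicomodules. -/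

import Mathlib

open TensorProduct CategoryTheory

universe u v

namespace CoalgDescent

noncomputable section

section Raw

variable {k : Type u} [Field k]
variable {C D E : Type v} [AddCommGroup C] [Module k C] [AddCommGroup D] [Module k D]
  [AddCommGroup E] [Module k E]
variable {U V V' W W' X Y Z : Type v} [AddCommGroup U] [Module k U] [AddCommGroup V] [Module k V]
  [AddCommGroup V'] [Module k V'] [AddCommGroup W] [Module k W] [AddCommGroup W'] [Module k W']
  [AddCommGroup X] [Module k X] [AddCommGroup Y] [Module k Y] [AddCommGroup Z] [Module k Z]

/-- Over a field, `Z ⊗ eq(a, b)` is the equalizer of `Z ⊗ a` and `Z ⊗ b`: a linear map into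
`Z ⊗ X` equalizing the latter factors through `Z ⊗ eq(a, b)`. -/
def liftL (a b : X →ₗ[k] Y) (t : U →ₗ[k] Z ⊗[k] X)
    (h : ∀ x, a.lTensor Z (t x) = b.lTensor Z (t x)) :
    U →ₗ[k] Z ⊗[k] (LinearMap.eqLocus a b) :=
  LinearMap.codRestrictOfInjective t ((LinearMap.eqLocus a b).subtype.lTensor Z)
    (Module.Flat.lTensor_preserves_injective_linearMap _ (Submodule.injective_subtype _))
    (fun x => by
      have := Module.Flat.eqLocus_lTensor_eq k Z a b
      change _ = LinearMap.range ((LinearMap.eqLocus a b).subtype.lTensor Z) at this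
      rw [← this]
      exact h x)

theorem liftL_spec (a b : X →ₗ[k] Y) (t : U →ₗ[k] Z ⊗[k] X)
    (h : ∀ x, a.lTensor Z (t x) = b.lTensor Z (t x)) (x : U) :
    (LinearMap.eqLocus a b).subtype.lTensor Z (liftL a b t h x) = t x :=
  LinearMap.codRestrictOfInjective_comp_apply t ((LinearMap.eqLocus a b).subtype.lTensor Z) _ _ x

/-- The mirror image of `liftL`. -/
def liftR (a b : X →ₗ[k] Y) (t : U →ₗ[k] X ⊗[k] Z)
    (h : ∀ x, a.rTensor Z (t x) = b.rTensor Z (t x)) :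
    U →ₗ[k] (LinearMap.eqLocus a b) ⊗[k] Z :=
  LinearMap.codRestrictOfInjective t ((LinearMap.eqLocus a b).subtype.rTensor Z)
    (Module.Flat.rTensor_preserves_injective_linearMap _ (Submodule.injective_subtype _))
    (fun x => by
      have h1 : ∀ s : Z ⊗[k] (LinearMap.eqLocus a b),
          (LinearMap.eqLocus a b).subtype.rTensor Z (TensorProduct.comm k _ _ s) =
            TensorProduct.comm k _ _ ((LinearMap.eqLocus a b).subtype.lTensor Z s) := fun s => by
        simp [LinearMap.rTensor, LinearMap.lTensor, TensorProduct.map_comm]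
      have h2 : ∀ (c : X →ₗ[k] Y) (s : X ⊗[k] Z),
          c.lTensor Z (TensorProduct.comm k _ _ s) =
            TensorProduct.comm k _ _ (c.rTensor Z s) := fun c s => by
        simp [LinearMap.rTensor, LinearMap.lTensor, TensorProduct.map_comm]
      refine ⟨TensorProduct.comm k _ _ (liftL a b
        ((TensorProduct.comm k X Z).toLinearMap ∘ₗ t) (fun y => ?_) x), ?_⟩
      · simp only [LinearMap.comp_apply, LinearEquiv.coe_coe, h2, h]
      · rw [h1, liftL_spec]
        simp)

theorem liftR_spec (a b : X →ₗ[k] Y) (t : U →ₗ[k] X ⊗[k] Z)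
    (h : ∀ x, a.rTensor Z (t x) = b.rTensor Z (t x)) (x : U) :
    (LinearMap.eqLocus a b).subtype.rTensor Z (liftR a b t h x) = t x :=
  LinearMap.codRestrictOfInjective_comp_apply t ((LinearMap.eqLocus a b).subtype.rTensor Z) _ _ x

/-- The cotensor product `V □_D W` of a right coaction `ρ : V → V ⊗ D` and a left coaction
`l : W → D ⊗ W`: the equalizer of `ρ ⊗ W` and `V ⊗ l`, as a subspace of `V ⊗ W`. -/
def cotensor (ρ : V →ₗ[k] V ⊗[k] D) (l : W →ₗ[k] D ⊗[k] W) : Submodule k (V ⊗[k] W) :=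
  LinearMap.eqLocus ((TensorProduct.assoc k V D W).toLinearMap ∘ₗ ρ.rTensor W) (l.lTensor V)

/-- The cotensor product `V □_D W` as a vector space. -/
def Cotensor (ρ : V →ₗ[k] V ⊗[k] D) (l : W →ₗ[k] D ⊗[k] W) : Type v := ↥(cotensor ρ l)

instance (ρ : V →ₗ[k] V ⊗[k] D) (l : W →ₗ[k] D ⊗[k] W) : AddCommGroup (Cotensor ρ l) :=
  inferInstanceAs (AddCommGroup ↥(cotensor ρ l))

instance (ρ : V →ₗ[k] V ⊗[k] D) (l : W →ₗ[k] D ⊗[k] W) : Module k (Cotensor ρ l) :=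
  inferInstanceAs (Module k ↥(cotensor ρ l))

/-- The inclusion `V □_D W ⊆ V ⊗ W`. -/
def incl (ρ : V →ₗ[k] V ⊗[k] D) (l : W →ₗ[k] D ⊗[k] W) : Cotensor ρ l →ₗ[k] V ⊗[k] W :=
  (cotensor ρ l).subtype

theorem incl_injective (ρ : V →ₗ[k] V ⊗[k] D) (l : W →ₗ[k] D ⊗[k] W) :
    Function.Injective (incl ρ l) :=
  Submodule.injective_subtype _

theorem incl_cond (ρ : V →ₗ[k] V ⊗[k] D) (l : W →ₗ[k] D ⊗[k] W) (x : Cotensor ρ l) :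
    TensorProduct.assoc k V D W (ρ.rTensor W (incl ρ l x)) = l.lTensor V (incl ρ l x) :=
  x.2

/-- A linear map into `V ⊗ W` with values in `V □_D W`, as a map into `V □_D W`. -/
def intoCot (ρ : V →ₗ[k] V ⊗[k] D) (l : W →ₗ[k] D ⊗[k] W) (t : U →ₗ[k] V ⊗[k] W)
    (h : ∀ x, TensorProduct.assoc k V D W (ρ.rTensor W (t x)) = l.lTensor V (t x)) :
    U →ₗ[k] Cotensor ρ l :=
  LinearMap.codRestrict (cotensor ρ l) t h

@[simp]
theorem incl_intoCot (ρ : V →ₗ[k] V ⊗[k] D) (l : W →ₗ[k] D ⊗[k] W) (t : U →ₗ[k] V ⊗[k] W)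
    (h : ∀ x, TensorProduct.assoc k V D W (ρ.rTensor W (t x)) = l.lTensor V (t x)) (x : U) :
    incl ρ l (intoCot ρ l t h x) = t x := rfl

theorem rTensor_inj {Z : Type*} [AddCommGroup Z] [Module k Z] (g : X →ₗ[k] Y)
    (hg : Function.Injective g) : Function.Injective (g.rTensor Z) :=
  Module.Flat.rTensor_preserves_injective_linearMap _ hg

theorem lTensor_inj {Z : Type*} [AddCommGroup Z] [Module k Z] (g : X →ₗ[k] Y)
    (hg : Function.Injective g) : Function.Injective (g.lTensor Z) :=
  Module.Flat.lTensor_preserves_injective_linearMap _ hg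

/-- A linear map into `Z ⊗ (V ⊗ W)` with values in `Z ⊗ (V □_D W)`. -/
def intoCotL (ρ : V →ₗ[k] V ⊗[k] D) (l : W →ₗ[k] D ⊗[k] W) (t : U →ₗ[k] Z ⊗[k] (V ⊗[k] W))
    (h : ∀ x, ((TensorProduct.assoc k V D W).toLinearMap ∘ₗ ρ.rTensor W).lTensor Z (t x) =
      (l.lTensor V).lTensor Z (t x)) :
    U →ₗ[k] Z ⊗[k] Cotensor ρ l :=
  liftL _ _ t h

theorem intoCotL_spec (ρ : V →ₗ[k] V ⊗[k] D) (l : W →ₗ[k] D ⊗[k] W)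
    (t : U →ₗ[k] Z ⊗[k] (V ⊗[k] W))
    (h : ∀ x, ((TensorProduct.assoc k V D W).toLinearMap ∘ₗ ρ.rTensor W).lTensor Z (t x) =
      (l.lTensor V).lTensor Z (t x)) (x : U) :
    (incl ρ l).lTensor Z (intoCotL ρ l t h x) = t x :=
  liftL_spec _ _ t h x

/-- A linear map into `(V ⊗ W) ⊗ Z` with values in `(V □_D W) ⊗ Z`. -/
def intoCotR (ρ : V →ₗ[k] V ⊗[k] D) (l : W →ₗ[k] D ⊗[k] W) (t : U →ₗ[k] (V ⊗[k] W) ⊗[k] Z)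
    (h : ∀ x, ((TensorProduct.assoc k V D W).toLinearMap ∘ₗ ρ.rTensor W).rTensor Z (t x) =
      (l.lTensor V).rTensor Z (t x)) :
    U →ₗ[k] Cotensor ρ l ⊗[k] Z :=
  liftR _ _ t h

theorem intoCotR_spec (ρ : V →ₗ[k] V ⊗[k] D) (l : W →ₗ[k] D ⊗[k] W)
    (t : U →ₗ[k] (V ⊗[k] W) ⊗[k] Z)
    (h : ∀ x, ((TensorProduct.assoc k V D W).toLinearMap ∘ₗ ρ.rTensor W).rTensor Z (t x) =
      (l.lTensor V).rTensor Z (t x)) (x : U) :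
    (incl ρ l).rTensor Z (intoCotR ρ l t h x) = t x :=
  liftR_spec _ _ t h x

/-- Coassociativity and counitality of a right coaction. -/
structure IsRightCoaction [Coalgebra k C] (ρ : V →ₗ[k] V ⊗[k] C) : Prop where
  coassoc : ∀ v, TensorProduct.assoc k V C C (ρ.rTensor C (ρ v)) =
    (Coalgebra.comul (R := k) (A := C)).lTensor V (ρ v)
  counit : ∀ v, (Coalgebra.counit (R := k) (A := C)).lTensor V (ρ v) = v ⊗ₜ[k] (1 : k)

/-- Coassociativity and counitality of a left coaction. -/
structure IsLeftCoaction [Coalgebra k C] (l : V →ₗ[k] C ⊗[k] V) : Prop where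
  coassoc : ∀ v, TensorProduct.assoc k C C V
    ((Coalgebra.comul (R := k) (A := C)).rTensor V (l v)) = l.lTensor C (l v)
  counit : ∀ v, (Coalgebra.counit (R := k) (A := C)).rTensor V (l v) = (1 : k) ⊗ₜ[k] v

/-- The compatibility of a left and a right coaction in a bicomodule. -/
def Commutes (l : V →ₗ[k] C ⊗[k] V) (ρ : V →ₗ[k] V ⊗[k] D) : Prop :=
  ∀ v, TensorProduct.assoc k C V D (l.rTensor D (ρ v)) = ρ.lTensor C (l v)

/-- `g` is a map of right comodules. -/
def RColinear (ρ : V →ₗ[k] V ⊗[k] D) (ρ' : V' →ₗ[k] V' ⊗[k] D) (g : V →ₗ[k] V') : Prop :=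
  ∀ v, ρ' (g v) = g.rTensor D (ρ v)

/-- `g` is a map of left comodules. -/
def LColinear (l : V →ₗ[k] D ⊗[k] V) (l' : V' →ₗ[k] D ⊗[k] V') (g : V →ₗ[k] V') : Prop :=
  ∀ v, l' (g v) = g.lTensor D (l v)

theorem RColinear.id (ρ : V →ₗ[k] V ⊗[k] D) : RColinear ρ ρ LinearMap.id := fun v => by simp

theorem LColinear.id (l : V →ₗ[k] D ⊗[k] V) : LColinear l l LinearMap.id := fun v => by simp

/-- Functoriality `g □ h : V □ W → V' □ W'` of the cotensor product. -/
def cotMap {ρ : V →ₗ[k] V ⊗[k] D} {ρ' : V' →ₗ[k] V' ⊗[k] D}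
    {l : W →ₗ[k] D ⊗[k] W} {l' : W' →ₗ[k] D ⊗[k] W'}
    (g : V →ₗ[k] V') (h : W →ₗ[k] W') (hg : RColinear ρ ρ' g) (hh : LColinear l l' h) :
    Cotensor ρ l →ₗ[k] Cotensor ρ' l' :=
  intoCot ρ' l' (TensorProduct.map g h ∘ₗ incl ρ l) (fun x => by
    have hx := incl_cond ρ l x
    have e1 : ∀ x : V ⊗[k] W,
        TensorProduct.assoc k V' D W' (ρ'.rTensor W' (TensorProduct.map g h x)) =
        TensorProduct.map g (h.lTensor D) (TensorProduct.assoc k V D W (ρ.rTensor W x)) := by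
      intro x
      refine x.induction_on (by simp) (fun a b => ?_)
        (fun _ _ ha hb => by simp only [map_add, ha, hb])
      obtain ⟨S, hS⟩ := exists_finset (ρ a)
      simp [hg a, hS, sum_tmul]
    have e2 : ∀ x : V ⊗[k] W, l'.lTensor V' (TensorProduct.map g h x) =
        TensorProduct.map g (h.lTensor D) (l.lTensor V x) := by
      intro x
      refine x.induction_on (by simp) (fun a b => ?_)
        (fun _ _ ha hb => by simp only [map_add, ha, hb])
      simp [hh b]
    rw [LinearMap.comp_apply, e1, e2, hx])

@[simp]
theorem coe_cotMap {ρ : V →ₗ[k] V ⊗[k] D} {ρ' : V' →ₗ[k] V' ⊗[k] D}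
    {l : W →ₗ[k] D ⊗[k] W} {l' : W' →ₗ[k] D ⊗[k] W'}
    (g : V →ₗ[k] V') (h : W →ₗ[k] W') (hg : RColinear ρ ρ' g) (hh : LColinear l l' h)
    (x : Cotensor ρ l) :
    incl ρ' l' (cotMap g h hg hh x) = TensorProduct.map g h (incl ρ l x) := rfl

/-- The right coaction on `V □_D W` induced by a right coaction `r` on `W`: the corestriction of
`V ⊗ r` to `(V □_D W) ⊗ C ⊆ V ⊗ W ⊗ C`. -/
def cotR (ρ : V →ₗ[k] V ⊗[k] D) (l : W →ₗ[k] D ⊗[k] W) (r : W →ₗ[k] W ⊗[k] C)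
    (hc : Commutes l r) : Cotensor ρ l →ₗ[k] Cotensor ρ l ⊗[k] C :=
  intoCotR ρ l ((TensorProduct.assoc k V W C).symm.toLinearMap ∘ₗ r.lTensor V ∘ₗ
    (incl ρ l)) (by
      intro x
      have hx := incl_cond ρ l x
      let Φ : V ⊗[k] (D ⊗[k] W) →ₗ[k] (V ⊗[k] (D ⊗[k] W)) ⊗[k] C :=
        (TensorProduct.assoc k V (D ⊗[k] W) C).symm.toLinearMap ∘ₗ
          ((TensorProduct.assoc k D W C).symm.toLinearMap ∘ₗ r.lTensor D).lTensor V
      have e1 : ∀ x : V ⊗[k] W, ((TensorProduct.assoc k V D W).toLinearMap ∘ₗ ρ.rTensor W).rTensor C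
          ((TensorProduct.assoc k V W C).symm (r.lTensor V x)) =
          Φ (TensorProduct.assoc k V D W (ρ.rTensor W x)) := by
        intro x
        refine x.induction_on (by simp) (fun a b => ?_)
          (fun _ _ ha hb => by simp only [map_add, ha, hb])
        obtain ⟨S, hS⟩ := exists_finset (ρ a)
        obtain ⟨T, hT⟩ := exists_finset (r b)
        simp [Φ, hS, hT, sum_tmul, tmul_sum]
        try exact Finset.sum_comm
      have e2 : ∀ x : V ⊗[k] W, (l.lTensor V).rTensor C
          ((TensorProduct.assoc k V W C).symm (r.lTensor V x)) = Φ (l.lTensor V x) := by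
        intro x
        refine x.induction_on (by simp) (fun a b => ?_)
          (fun _ _ ha hb => by simp only [map_add, ha, hb])
        have := hc b
        simp only [Φ, LinearMap.comp_apply, LinearMap.lTensor_tmul, LinearEquiv.coe_coe]
        rw [← this, LinearEquiv.symm_apply_apply]
        obtain ⟨T, hT⟩ := exists_finset (r b)
        simp [hT, tmul_sum]
      simpa [e1, e2] using congrArg Φ hx)

theorem cotR_spec (ρ : V →ₗ[k] V ⊗[k] D) (l : W →ₗ[k] D ⊗[k] W) (r : W →ₗ[k] W ⊗[k] C)
    (hc : Commutes l r) (x : Cotensor ρ l) :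
    (incl ρ l).rTensor C (cotR ρ l r hc x) =
      (TensorProduct.assoc k V W C).symm (r.lTensor V (incl ρ l x)) :=
  intoCotR_spec _ _ _ _ x

/-- The left coaction on `V □_D W` induced by a left coaction `m` on `V`: the corestriction of
`m ⊗ W` to `E ⊗ (V □_D W) ⊆ E ⊗ V ⊗ W`. -/
def cotL (ρ : V →ₗ[k] V ⊗[k] D) (l : W →ₗ[k] D ⊗[k] W) (m : V →ₗ[k] E ⊗[k] V)
    (hc : Commutes m ρ) : Cotensor ρ l →ₗ[k] E ⊗[k] Cotensor ρ l :=
  intoCotL ρ l ((TensorProduct.assoc k E V W).toLinearMap ∘ₗ m.rTensor W ∘ₗ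
    (incl ρ l)) (by
      intro x
      have hx := incl_cond ρ l x
      let Φ : V ⊗[k] (D ⊗[k] W) →ₗ[k] E ⊗[k] (V ⊗[k] (D ⊗[k] W)) :=
        (TensorProduct.assoc k E V (D ⊗[k] W)).toLinearMap ∘ₗ m.rTensor (D ⊗[k] W)
      have e1 : ∀ x : V ⊗[k] W, ((TensorProduct.assoc k V D W).toLinearMap ∘ₗ ρ.rTensor W).lTensor E
          (TensorProduct.assoc k E V W (m.rTensor W x)) =
          Φ (TensorProduct.assoc k V D W (ρ.rTensor W x)) := by
        intro x
        refine x.induction_on (by simp) (fun a b => ?_)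
          (fun _ _ ha hb => by simp only [map_add, ha, hb])
        have h := congrArg (fun t => (TensorProduct.assoc k V D W).toLinearMap.lTensor E
          (TensorProduct.assoc k E (V ⊗[k] D) W (t ⊗ₜ[k] b))) (hc a)
        obtain ⟨T, hT⟩ := exists_finset (m a)
        obtain ⟨S, hS⟩ := exists_finset (ρ a)
        choose T' hT' using fun v => exists_finset (m v)
        simp only [hS, hT, map_sum, sum_tmul, LinearMap.rTensor_tmul, LinearMap.lTensor_tmul,
          TensorProduct.assoc_tmul, LinearEquiv.coe_coe, hT', Φ, LinearMap.comp_apply] at h ⊢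
        exact h.symm
      have e2 : ∀ x : V ⊗[k] W, (l.lTensor V).lTensor E
          (TensorProduct.assoc k E V W (m.rTensor W x)) = Φ (l.lTensor V x) := by
        intro x
        refine x.induction_on (by simp) (fun a b => ?_)
          (fun _ _ ha hb => by simp only [map_add, ha, hb])
        obtain ⟨T, hT⟩ := exists_finset (m a)
        simp [Φ, hT, sum_tmul]
      simpa [e1, e2] using congrArg Φ hx)

theorem cotL_spec (ρ : V →ₗ[k] V ⊗[k] D) (l : W →ₗ[k] D ⊗[k] W) (m : V →ₗ[k] E ⊗[k] V)
    (hc : Commutes m ρ) (x : Cotensor ρ l) :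
    (incl ρ l).lTensor E (cotL ρ l m hc x) =
      TensorProduct.assoc k E V W (m.rTensor W (incl ρ l x)) :=
  intoCotL_spec _ _ _ _ x

theorem natR (g : X →ₗ[k] Y) (t : X ⊗[k] U) (z : Z) :
    g.rTensor (U ⊗[k] Z) (TensorProduct.assoc k X U Z (t ⊗ₜ[k] z)) =
      TensorProduct.assoc k Y U Z (g.rTensor U t ⊗ₜ[k] z) := by
  refine t.induction_on (by simp) (fun a b => ?_)
    (fun _ _ ha hb => by simp only [map_add, add_tmul, ha, hb])
  simp

/-- The right coaction on a Cotensor product is coassociative and counital. -/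
theorem cotR_isRightCoaction [Coalgebra k C] (ρ : V →ₗ[k] V ⊗[k] D) (l : W →ₗ[k] D ⊗[k] W)
    (r : W →ₗ[k] W ⊗[k] C) (hc : Commutes l r) (hr : IsRightCoaction r) :
    IsRightCoaction (cotR ρ l r hc) where
  coassoc y := by
    apply rTensor_inj _ (incl_injective ρ l)
    have h1 : ∀ z, (incl ρ l).rTensor (C ⊗[k] C)
        (TensorProduct.assoc k _ C C ((cotR ρ l r hc).rTensor C z)) =
        TensorProduct.assoc k _ C C (((TensorProduct.assoc k V W C).symm.toLinearMap ∘ₗ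
          r.lTensor V).rTensor C ((incl ρ l).rTensor C z)) := by
      intro z
      refine z.induction_on (by simp) (fun a b => ?_)
        (fun _ _ ha hb => by simp only [map_add, ha, hb])
      simp only [LinearMap.rTensor_tmul]
      rw [natR, cotR_spec]
      simp
    have h2 : ∀ z, (incl ρ l).rTensor (C ⊗[k] C)
        ((Coalgebra.comul (R := k) (A := C)).lTensor _ z) =
        (Coalgebra.comul (R := k) (A := C)).lTensor _ ((incl ρ l).rTensor C z) := by
      intro z
      refine z.induction_on (by simp) (fun a b => ?_)
        (fun _ _ ha hb => by simp only [map_add, ha, hb])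
      simp
    have h3 : ∀ x : V ⊗[k] W, TensorProduct.assoc k _ C C
        (((TensorProduct.assoc k V W C).symm.toLinearMap ∘ₗ r.lTensor V).rTensor C
          ((TensorProduct.assoc k V W C).symm (r.lTensor V x))) =
        (Coalgebra.comul (R := k) (A := C)).lTensor _
          ((TensorProduct.assoc k V W C).symm (r.lTensor V x)) := by
      intro x
      refine x.induction_on (by simp) (fun a b => ?_)
        (fun _ _ ha hb => by simp only [map_add, ha, hb])
      have h := congrArg (fun t => (TensorProduct.assoc k V W (C ⊗[k] C)).symm (a ⊗ₜ[k] t))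
        (hr.coassoc b)
      choose S hS using fun w => exists_finset (r w)
      choose T hT using fun c => exists_finset (Coalgebra.comul (R := k) (A := C) c)
      simp only [hS, hT, map_sum, sum_tmul, tmul_sum, LinearMap.rTensor_tmul,
        LinearMap.lTensor_tmul, TensorProduct.assoc_tmul, TensorProduct.assoc_symm_tmul,
        LinearEquiv.coe_coe, LinearMap.comp_apply] at h ⊢
      exact h
    rw [h1, h2, cotR_spec, h3]
  counit y := by
    apply rTensor_inj _ (incl_injective ρ l)
    have h2 : ∀ z, (incl ρ l).rTensor k
        ((Coalgebra.counit (R := k) (A := C)).lTensor _ z) =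
        (Coalgebra.counit (R := k) (A := C)).lTensor _ ((incl ρ l).rTensor C z) := by
      intro z
      refine z.induction_on (by simp) (fun a b => ?_)
        (fun _ _ ha hb => by simp only [map_add, ha, hb])
      simp
    have h3 : ∀ x : V ⊗[k] W, (Coalgebra.counit (R := k) (A := C)).lTensor _
          ((TensorProduct.assoc k V W C).symm (r.lTensor V x)) = x ⊗ₜ[k] (1 : k) := by
      intro x
      refine x.induction_on (by simp) (fun a b => ?_)
        (fun _ _ ha hb => by simp only [map_add, add_tmul, ha, hb])
      have h := congrArg (fun t => (TensorProduct.assoc k V W k).symm (a ⊗ₜ[k] t))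
        (hr.counit b)
      choose S hS using fun w => exists_finset (r w)
      simp only [hS, map_sum, tmul_sum, LinearMap.lTensor_tmul,
        TensorProduct.assoc_symm_tmul] at h ⊢
      exact h
    rw [h2, cotR_spec, h3]
    simp

/-- The left coaction on a Cotensor product is coassociative and counital. -/
theorem cotL_isLeftCoaction [Coalgebra k E] (ρ : V →ₗ[k] V ⊗[k] D) (l : W →ₗ[k] D ⊗[k] W)
    (m : V →ₗ[k] E ⊗[k] V) (hc : Commutes m ρ) (hm : IsLeftCoaction m) :
    IsLeftCoaction (cotL ρ l m hc) where
  coassoc y := by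
    apply Module.Flat.lTensor_preserves_injective_linearMap (M := E) _
      (lTensor_inj (Z := E) _ (incl_injective ρ l))
    have h1 : ∀ z, ((incl ρ l).lTensor E).lTensor E ((cotL ρ l m hc).lTensor E z) =
        ((TensorProduct.assoc k E V W).toLinearMap ∘ₗ m.rTensor W).lTensor E
          ((incl ρ l).lTensor E z) := by
      intro z
      refine z.induction_on (by simp) (fun a b => ?_)
        (fun _ _ ha hb => by simp only [map_add, ha, hb])
      simp only [LinearMap.lTensor_tmul]
      rw [cotL_spec]
      simp
    have h2 : ∀ z, ((incl ρ l).lTensor E).lTensor E (TensorProduct.assoc k E E _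
        ((Coalgebra.comul (R := k) (A := E)).rTensor _ z)) =
        TensorProduct.assoc k E E _ ((Coalgebra.comul (R := k) (A := E)).rTensor _
          ((incl ρ l).lTensor E z)) := by
      intro z
      refine z.induction_on (by simp) (fun a b => ?_)
        (fun _ _ ha hb => by simp only [map_add, ha, hb])
      obtain ⟨T, hT⟩ := exists_finset (Coalgebra.comul (R := k) (A := E) a)
      simp [hT, sum_tmul]
    have h3 : ∀ x : V ⊗[k] W, TensorProduct.assoc k E E _
        ((Coalgebra.comul (R := k) (A := E)).rTensor _
          (TensorProduct.assoc k E V W (m.rTensor W x))) =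
        ((TensorProduct.assoc k E V W).toLinearMap ∘ₗ m.rTensor W).lTensor E
          (TensorProduct.assoc k E V W (m.rTensor W x)) := by
      intro x
      refine x.induction_on (by simp) (fun a b => ?_)
        (fun _ _ ha hb => by simp only [map_add, ha, hb])
      have h := congrArg (fun t => (TensorProduct.assoc k E V W).toLinearMap.lTensor E
        (TensorProduct.assoc k E (E ⊗[k] V) W (t ⊗ₜ[k] b))) (hm.coassoc a)
      choose S hS using fun w => exists_finset (m w)
      choose T hT using fun c => exists_finset (Coalgebra.comul (R := k) (A := E) c)
      simp only [hS, hT, map_sum, sum_tmul, tmul_sum, LinearMap.rTensor_tmul,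
        LinearMap.lTensor_tmul, TensorProduct.assoc_tmul,
        LinearEquiv.coe_coe, LinearMap.comp_apply] at h ⊢
      exact h
    rw [h1, h2, cotL_spec, h3]
  counit y := by
    apply lTensor_inj _ (incl_injective ρ l)
    have h2 : ∀ z, (incl ρ l).lTensor k
        ((Coalgebra.counit (R := k) (A := E)).rTensor _ z) =
        (Coalgebra.counit (R := k) (A := E)).rTensor _ ((incl ρ l).lTensor E z) := by
      intro z
      refine z.induction_on (by simp) (fun a b => ?_)
        (fun _ _ ha hb => by simp only [map_add, ha, hb])
      simp
    have h3 : ∀ x : V ⊗[k] W, (Coalgebra.counit (R := k) (A := E)).rTensor _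
          (TensorProduct.assoc k E V W (m.rTensor W x)) = (1 : k) ⊗ₜ[k] x := by
      intro x
      refine x.induction_on (by simp) (fun a b => ?_)
        (fun _ _ ha hb => by simp only [map_add, tmul_add, ha, hb])
      have h := congrArg (fun t => TensorProduct.assoc k k V W (t ⊗ₜ[k] b)) (hm.counit a)
      choose S hS using fun w => exists_finset (m w)
      simp only [hS, map_sum, sum_tmul, LinearMap.rTensor_tmul,
        TensorProduct.assoc_tmul] at h ⊢
      exact h
    rw [h2, cotL_spec, h3]
    simp

/-- The two induced coactions make `V □_D W` a bicomodule. -/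
theorem cot_commutes (ρ : V →ₗ[k] V ⊗[k] D) (l : W →ₗ[k] D ⊗[k] W) (m : V →ₗ[k] E ⊗[k] V)
    (hm : Commutes m ρ) (r : W →ₗ[k] W ⊗[k] C) (hr : Commutes l r) :
    Commutes (cotL ρ l m hm) (cotR ρ l r hr) := by
  intro y
  apply Module.Flat.lTensor_preserves_injective_linearMap (M := E) _
      (rTensor_inj (Z := C) _ (incl_injective ρ l))
  have h1 : ∀ z, ((incl ρ l).rTensor C).lTensor E ((cotR ρ l r hr).lTensor E z) =
      ((TensorProduct.assoc k V W C).symm.toLinearMap ∘ₗ r.lTensor V).lTensor E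
        ((incl ρ l).lTensor E z) := by
    intro z
    refine z.induction_on (by simp) (fun a b => ?_)
      (fun _ _ ha hb => by simp only [map_add, ha, hb])
    simp only [LinearMap.lTensor_tmul]
    rw [cotR_spec]
    simp
  have h0 : ∀ (t : E ⊗[k] Cotensor ρ l) (c : C), ((incl ρ l).rTensor C).lTensor E
      (TensorProduct.assoc k E _ C (t ⊗ₜ[k] c)) = TensorProduct.assoc k E _ C
        ((incl ρ l).lTensor E t ⊗ₜ[k] c) := by
    intro t c
    refine t.induction_on (by simp) (fun a b => ?_)
      (fun _ _ ha hb => by simp only [map_add, add_tmul, ha, hb])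
    simp
  have h2 : ∀ z, ((incl ρ l).rTensor C).lTensor E
      (TensorProduct.assoc k E _ C ((cotL ρ l m hm).rTensor C z)) =
      TensorProduct.assoc k E _ C (((TensorProduct.assoc k E V W).toLinearMap ∘ₗ
        m.rTensor W).rTensor C ((incl ρ l).rTensor C z)) := by
    intro z
    refine z.induction_on (by simp) (fun a b => ?_)
      (fun _ _ ha hb => by simp only [map_add, ha, hb])
    simp only [LinearMap.rTensor_tmul]
    rw [h0, cotL_spec]
    simp
  have h3 : ∀ x : V ⊗[k] W, TensorProduct.assoc k E _ C
      (((TensorProduct.assoc k E V W).toLinearMap ∘ₗ m.rTensor W).rTensor C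
        ((TensorProduct.assoc k V W C).symm (r.lTensor V x))) =
      ((TensorProduct.assoc k V W C).symm.toLinearMap ∘ₗ r.lTensor V).lTensor E
        (TensorProduct.assoc k E V W (m.rTensor W x)) := by
    intro x
    refine x.induction_on (by simp) (fun a b => ?_)
      (fun _ _ ha hb => by simp only [map_add, ha, hb])
    obtain ⟨S, hS⟩ := exists_finset (m a)
    obtain ⟨T, hT⟩ := exists_finset (r b)
    simp only [hS, hT, map_sum, sum_tmul, tmul_sum, LinearMap.rTensor_tmul,
        LinearMap.lTensor_tmul, TensorProduct.assoc_tmul, TensorProduct.assoc_symm_tmul,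
        LinearEquiv.coe_coe, LinearMap.comp_apply]
    first | done | exact Finset.sum_comm
  rw [h1, h2, cotR_spec, cotL_spec, h3]

/-- The associativity map `(V □_C W) □_D X → V □_C (W □_D X)`: the restriction of
`(V ⊗ W) ⊗ X ≅ V ⊗ (W ⊗ X)`. -/
def cotAssoc (ρ : V →ₗ[k] V ⊗[k] C) (l : W →ₗ[k] C ⊗[k] W) (r : W →ₗ[k] W ⊗[k] D)
    (hc : Commutes l r) (m : X →ₗ[k] D ⊗[k] X) :
    Cotensor (cotR ρ l r hc) m →ₗ[k] Cotensor ρ (cotL r m l hc) :=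
  intoCot ρ (cotL r m l hc)
    (intoCotL r m
      ((TensorProduct.assoc k V W X).toLinearMap ∘ₗ
      (incl ρ l).rTensor X ∘ₗ incl (cotR ρ l r hc) m) (by
        intro x
        have hx := incl_cond _ _ x
        have h := congrArg (fun t => TensorProduct.assoc k V W (D ⊗[k] X)
          ((incl ρ l).rTensor (D ⊗[k] X) t)) hx
        have e1 : ∀ x, TensorProduct.assoc k V W (D ⊗[k] X) ((incl ρ l).rTensor _
            (TensorProduct.assoc k _ D X ((cotR ρ l r hc).rTensor X x))) =
            ((TensorProduct.assoc k W D X).toLinearMap ∘ₗ r.rTensor X).lTensor V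
              (TensorProduct.assoc k V W X ((incl ρ l).rTensor X x)) := by
          intro x
          refine x.induction_on (by simp) (fun a b => ?_)
            (fun _ _ ha hb => by simp only [map_add, ha, hb])
          simp only [LinearMap.rTensor_tmul]
          rw [natR, cotR_spec]
          generalize incl ρ l a = a'
          refine a'.induction_on (by simp) (fun v w => ?_)
            (fun _ _ ha hb => by simp only [map_add, add_tmul, ha, hb])
          obtain ⟨S, hS⟩ := exists_finset (r w)
          simp [hS, sum_tmul, tmul_sum]
        have e2 : ∀ x, TensorProduct.assoc k V W (D ⊗[k] X) ((incl ρ l).rTensor _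
            (m.lTensor _ x)) = (m.lTensor W).lTensor V
              (TensorProduct.assoc k V W X ((incl ρ l).rTensor X x)) := by
          intro x
          refine x.induction_on (by simp) (fun a b => ?_)
            (fun _ _ ha hb => by simp only [map_add, ha, hb])
          simp only [LinearMap.rTensor_tmul, LinearMap.lTensor_tmul]
          generalize incl ρ l a = a'
          refine a'.induction_on (by simp) (fun v w => ?_)
            (fun _ _ ha hb => by simp only [map_add, add_tmul, ha, hb])
          simp
        simp only [e1, e2] at h
        exact h))
    (by
      intro x
      apply Module.Flat.lTensor_preserves_injective_linearMap (M := V) _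
        (Module.Flat.lTensor_preserves_injective_linearMap (M := C) _
          (incl_injective r m))
      have e1 : ∀ z, ((incl r m).lTensor C).lTensor V
          (TensorProduct.assoc k V C _ (ρ.rTensor _ z)) =
          TensorProduct.assoc k V C _ (ρ.rTensor _ ((incl r m).lTensor V z)) := by
        intro z
        refine z.induction_on (by simp) (fun a b => ?_)
          (fun _ _ ha hb => by simp only [map_add, ha, hb])
        obtain ⟨S, hS⟩ := exists_finset (ρ a)
        simp [hS, sum_tmul]
      have e2 : ∀ z, ((incl r m).lTensor C).lTensor V
          ((cotL r m l hc).lTensor V z) =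
          ((TensorProduct.assoc k C W X).toLinearMap ∘ₗ l.rTensor X).lTensor V
            ((incl r m).lTensor V z) := by
        intro z
        refine z.induction_on (by simp) (fun a b => ?_)
          (fun _ _ ha hb => by simp only [map_add, ha, hb])
        simp only [LinearMap.lTensor_tmul]
        rw [cotL_spec]
        simp
      have e3 : ∀ y : Cotensor ρ l ⊗[k] X, TensorProduct.assoc k V C _ (ρ.rTensor _
          (TensorProduct.assoc k V W X ((incl ρ l).rTensor X y))) =
          ((TensorProduct.assoc k C W X).toLinearMap ∘ₗ l.rTensor X).lTensor V
            (TensorProduct.assoc k V W X ((incl ρ l).rTensor X y)) := by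
        intro y
        refine y.induction_on (by simp) (fun a b => ?_)
          (fun _ _ ha hb => by simp only [map_add, ha, hb])
        have ha := incl_cond ρ l a
        have h := congrArg (fun t => (TensorProduct.assoc k C W X).toLinearMap.lTensor V
          (TensorProduct.assoc k V (C ⊗[k] W) X (t ⊗ₜ[k] b))) ha
        have e4 : ∀ a : V ⊗[k] W, (TensorProduct.assoc k C W X).toLinearMap.lTensor V
            (TensorProduct.assoc k V (C ⊗[k] W) X
              (TensorProduct.assoc k V C W (ρ.rTensor W a) ⊗ₜ[k] b)) =
            TensorProduct.assoc k V C _ (ρ.rTensor _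
              (TensorProduct.assoc k V W X (a ⊗ₜ[k] b))) := by
          intro a
          refine a.induction_on (by simp) (fun v w => ?_)
            (fun _ _ ha hb => by simp only [map_add, add_tmul, ha, hb])
          obtain ⟨S, hS⟩ := exists_finset (ρ v)
          simp [hS, sum_tmul]
        have e5 : ∀ a : V ⊗[k] W, (TensorProduct.assoc k C W X).toLinearMap.lTensor V
            (TensorProduct.assoc k V (C ⊗[k] W) X (l.lTensor V a ⊗ₜ[k] b)) =
            ((TensorProduct.assoc k C W X).toLinearMap ∘ₗ l.rTensor X).lTensor V
              (TensorProduct.assoc k V W X (a ⊗ₜ[k] b)) := by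
          intro a
          refine a.induction_on (by simp) (fun v w => ?_)
            (fun _ _ ha hb => by simp only [map_add, add_tmul, ha, hb])
          simp
        simp only [e4, e5] at h
        exact h
      rw [e1, e2]
      rw [intoCotL_spec]
      exact e3 _)

theorem cotAssoc_spec (ρ : V →ₗ[k] V ⊗[k] C) (l : W →ₗ[k] C ⊗[k] W) (r : W →ₗ[k] W ⊗[k] D)
    (hc : Commutes l r) (m : X →ₗ[k] D ⊗[k] X) (x : Cotensor (cotR ρ l r hc) m) :
    (incl r m).lTensor V (incl _ _ (cotAssoc ρ l r hc m x)) =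
      TensorProduct.assoc k V W X
        ((incl ρ l).rTensor X (incl _ _ x)) := by
  rw [cotAssoc, incl_intoCot, intoCotL_spec]
  rfl

/-- `V ⊗ C → V`, `v ⊗ c ↦ ε(c) v`. -/
def rEps (V : Type v) [AddCommGroup V] [Module k V] [Coalgebra k C] : V ⊗[k] C →ₗ[k] V :=
  (TensorProduct.rid k V).toLinearMap ∘ₗ (Coalgebra.counit (R := k) (A := C)).lTensor V

/-- `C ⊗ W → W`, `c ⊗ w ↦ ε(c) w`. -/
def lEps (W : Type v) [AddCommGroup W] [Module k W] [Coalgebra k C] : C ⊗[k] W →ₗ[k] W :=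
  (TensorProduct.lid k W).toLinearMap ∘ₗ (Coalgebra.counit (R := k) (A := C)).rTensor W

@[simp]
theorem rEps_tmul [Coalgebra k C] (a : V) (c : C) :
    rEps (k := k) V (a ⊗ₜ[k] c) = Coalgebra.counit (R := k) c • a := by
  simp [rEps]

@[simp]
theorem lEps_tmul [Coalgebra k C] (c : C) (a : W) :
    lEps (k := k) W (c ⊗ₜ[k] a) = Coalgebra.counit (R := k) c • a := by
  simp [lEps]

theorem IsRightCoaction.rEps [Coalgebra k C] {ρ : V →ₗ[k] V ⊗[k] C} (h : IsRightCoaction ρ)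
    (a : V) : rEps V (ρ a) = a := by
  have := h.counit a
  simp [CoalgDescent.rEps, this]

theorem comul_isRightCoaction [Coalgebra k C] :
    IsRightCoaction (Coalgebra.comul (R := k) (A := C)) :=
  ⟨fun c => by simp, fun c => by simp⟩

theorem comul_isLeftCoaction [Coalgebra k C] :
    IsLeftCoaction (Coalgebra.comul (R := k) (A := C)) :=
  ⟨fun c => by simp, fun c => by simp⟩

theorem comul_commutes [Coalgebra k C] :
    Commutes (Coalgebra.comul (R := k) (A := C)) (Coalgebra.comul (R := k) (A := C)) :=
  fun c => by simp

variable [Coalgebra k C] [Coalgebra k D]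

/-- The corestriction of a right `C`-coaction along a coalgebra morphism `f : C → D`. -/
def corestR (f : C →ₗc[k] D) (ρ : V →ₗ[k] V ⊗[k] C) : V →ₗ[k] V ⊗[k] D :=
  (f : C →ₗ[k] D).lTensor V ∘ₗ ρ

/-- The corestriction of a left `C`-coaction along a coalgebra morphism `f : C → D`. -/
def corestL (f : C →ₗc[k] D) (l : V →ₗ[k] C ⊗[k] V) : V →ₗ[k] D ⊗[k] V :=
  (f : C →ₗ[k] D).rTensor V ∘ₗ l

theorem corestR_isRightCoaction (f : C →ₗc[k] D) {ρ : V →ₗ[k] V ⊗[k] C}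
    (h : IsRightCoaction ρ) : IsRightCoaction (corestR f ρ) where
  coassoc a := by
    have h1 := congrArg ((TensorProduct.map (f : C →ₗ[k] D) (f : C →ₗ[k] D)).lTensor V)
      (h.coassoc a)
    have e1 : ∀ z, TensorProduct.assoc k V D D ((corestR f ρ).rTensor D
        ((f : C →ₗ[k] D).lTensor V z)) =
        (TensorProduct.map (f : C →ₗ[k] D) (f : C →ₗ[k] D)).lTensor V
          (TensorProduct.assoc k V C C (ρ.rTensor C z)) := by
      intro z
      refine z.induction_on (by simp) (fun a b => ?_)
        (fun _ _ ha hb => by simp only [map_add, ha, hb])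
      obtain ⟨S, hS⟩ := exists_finset (ρ a)
      simp [corestR, hS, sum_tmul]
    have e2 : ∀ z, (Coalgebra.comul (R := k) (A := D)).lTensor V
        ((f : C →ₗ[k] D).lTensor V z) =
        (TensorProduct.map (f : C →ₗ[k] D) (f : C →ₗ[k] D)).lTensor V
          ((Coalgebra.comul (R := k) (A := C)).lTensor V z) := by
      intro z
      refine z.induction_on (by simp) (fun a b => ?_)
        (fun _ _ ha hb => by simp only [map_add, ha, hb])
      have := CoalgHomClass.map_comp_comul_apply f b
      simp only [LinearMap.lTensor_tmul]
      exact congrArg (fun t => a ⊗ₜ[k] t) this.symm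
    change TensorProduct.assoc k V D D ((corestR f ρ).rTensor D
        ((f : C →ₗ[k] D).lTensor V (ρ a))) = (Coalgebra.comul (R := k) (A := D)).lTensor V
        ((f : C →ₗ[k] D).lTensor V (ρ a))
    rw [e1, e2, h1]
  counit a := by
    have e2 : ∀ z, (Coalgebra.counit (R := k) (A := D)).lTensor V
        ((f : C →ₗ[k] D).lTensor V z) = (Coalgebra.counit (R := k) (A := C)).lTensor V z := by
      intro z
      refine z.induction_on (by simp) (fun a b => ?_)
        (fun _ _ ha hb => by simp only [map_add, ha, hb])
      simp
    change (Coalgebra.counit (R := k) (A := D)).lTensor V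
        ((f : C →ₗ[k] D).lTensor V (ρ a)) = _
    rw [e2, h.counit]

theorem corestL_isLeftCoaction (f : C →ₗc[k] D) {l : V →ₗ[k] C ⊗[k] V}
    (h : IsLeftCoaction l) : IsLeftCoaction (corestL f l) where
  coassoc a := by
    have h1 := congrArg (((f : C →ₗ[k] D).rTensor V ∘ₗ LinearMap.id).lTensor D)
      (congrArg ((f : C →ₗ[k] D).rTensor (C ⊗[k] V)) (h.coassoc a))
    have e1 : ∀ z, (corestL f l).lTensor D ((f : C →ₗ[k] D).rTensor V z) =
        ((f : C →ₗ[k] D).rTensor V ∘ₗ LinearMap.id).lTensor D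
          ((f : C →ₗ[k] D).rTensor (C ⊗[k] V) (l.lTensor C z)) := by
      intro z
      refine z.induction_on (by simp) (fun a b => ?_)
        (fun _ _ ha hb => by simp only [map_add, ha, hb])
      simp [corestL]
    have e2 : ∀ z, TensorProduct.assoc k D D V ((Coalgebra.comul (R := k) (A := D)).rTensor V
        ((f : C →ₗ[k] D).rTensor V z)) =
        ((f : C →ₗ[k] D).rTensor V ∘ₗ LinearMap.id).lTensor D
          ((f : C →ₗ[k] D).rTensor (C ⊗[k] V) (TensorProduct.assoc k C C V
          ((Coalgebra.comul (R := k) (A := C)).rTensor V z))) := by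
      intro z
      refine z.induction_on (by simp) (fun a b => ?_)
        (fun _ _ ha hb => by simp only [map_add, ha, hb])
      have := CoalgHomClass.map_comp_comul_apply f a
      obtain ⟨S, hS⟩ := exists_finset (Coalgebra.comul (R := k) (A := C) a)
      simp [← this, hS, sum_tmul]
    change TensorProduct.assoc k D D V ((Coalgebra.comul (R := k) (A := D)).rTensor V
        ((f : C →ₗ[k] D).rTensor V (l a))) = (corestL f l).lTensor D
        ((f : C →ₗ[k] D).rTensor V (l a))
    rw [e1, e2, h1]
  counit a := by
    have e2 : ∀ z, (Coalgebra.counit (R := k) (A := D)).rTensor V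
        ((f : C →ₗ[k] D).rTensor V z) = (Coalgebra.counit (R := k) (A := C)).rTensor V z := by
      intro z
      refine z.induction_on (by simp) (fun a b => ?_)
        (fun _ _ ha hb => by simp only [map_add, ha, hb])
      simp
    change (Coalgebra.counit (R := k) (A := D)).rTensor V
        ((f : C →ₗ[k] D).rTensor V (l a)) = _
    rw [e2, h.counit]

theorem Commutes.corestR (f : C →ₗc[k] D) {l : V →ₗ[k] E ⊗[k] V} {ρ : V →ₗ[k] V ⊗[k] C}
    (h : Commutes l ρ) : Commutes l (corestR f ρ) := by
  intro a
  have h1 := congrArg (((f : C →ₗ[k] D).lTensor V).lTensor E) (h a)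
  have e1 : ∀ z, TensorProduct.assoc k E V D (l.rTensor D ((f : C →ₗ[k] D).lTensor V z)) =
      ((f : C →ₗ[k] D).lTensor V).lTensor E (TensorProduct.assoc k E V C (l.rTensor C z)) := by
    intro z
    refine z.induction_on (by simp) (fun a b => ?_)
      (fun _ _ ha hb => by simp only [map_add, ha, hb])
    obtain ⟨S, hS⟩ := exists_finset (l a)
    simp [hS, sum_tmul]
  change TensorProduct.assoc k E V D (l.rTensor D ((f : C →ₗ[k] D).lTensor V (ρ a))) = _
  rw [e1, h1, CoalgDescent.corestR, LinearMap.lTensor_comp, LinearMap.comp_apply]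

theorem Commutes.corestL (f : C →ₗc[k] D) {l : V →ₗ[k] C ⊗[k] V} {ρ : V →ₗ[k] V ⊗[k] E}
    (h : Commutes l ρ) : Commutes (corestL f l) ρ := by
  intro a
  have h1 := congrArg ((f : C →ₗ[k] D).rTensor (V ⊗[k] E)) (h a)
  have e1 : ∀ z, ρ.lTensor D ((f : C →ₗ[k] D).rTensor V z) =
      (f : C →ₗ[k] D).rTensor (V ⊗[k] E) (ρ.lTensor C z) := by
    intro z
    refine z.induction_on (by simp) (fun a b => ?_)
      (fun _ _ ha hb => by simp only [map_add, ha, hb])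
    simp
  have e2 : ∀ z, TensorProduct.assoc k D V E ((CoalgDescent.corestL f l).rTensor E z) =
      (f : C →ₗ[k] D).rTensor (V ⊗[k] E) (TensorProduct.assoc k C V E (l.rTensor E z)) := by
    intro z
    refine z.induction_on (by simp) (fun a b => ?_)
      (fun _ _ ha hb => by simp only [map_add, ha, hb])
    obtain ⟨S, hS⟩ := exists_finset (l a)
    simp [CoalgDescent.corestL, hS, sum_tmul]
  change _ = ρ.lTensor D ((f : C →ₗ[k] D).rTensor V (l a))
  rw [e1, e2, h1]

/-- `C` as a left `D`-comodule along `f`. -/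
abbrev lamf (f : C →ₗc[k] D) : C →ₗ[k] D ⊗[k] C := corestL f (Coalgebra.comul (R := k) (A := C))

/-- `C` as a right `D`-comodule along `f`. -/
abbrev rhof (f : C →ₗc[k] D) : C →ₗ[k] C ⊗[k] D := corestR f (Coalgebra.comul (R := k) (A := C))

theorem lamf_commutes (f : C →ₗc[k] D) : Commutes (lamf f) (Coalgebra.comul (R := k) (A := C)) :=
  comul_commutes.corestL f

theorem rhof_commutes (f : C →ₗc[k] D) : Commutes (Coalgebra.comul (R := k) (A := C)) (rhof f) :=
  comul_commutes.corestR f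

/-- On `W □_D C`: `w₀ ⊗ w₁ ε(c) = w ⊗ f(c)`. -/
theorem coact_rEps (f : C →ₗc[k] D) (ρ : W →ₗ[k] W ⊗[k] D) (y : Cotensor ρ (lamf f)) :
    ρ (rEps W (incl _ _ y)) = (f : C →ₗ[k] D).lTensor W (incl _ _ y) := by
  have h := congrArg ((rEps (k := k) (C := C) D).lTensor W) (incl_cond _ _ y)
  have e1 : ∀ z, (rEps (k := k) (C := C) D).lTensor W
      (TensorProduct.assoc k W D C (ρ.rTensor C z)) = ρ (rEps W z) := by
    intro z
    refine z.induction_on (by simp) (fun a b => ?_)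
      (fun _ _ ha hb => by simp only [map_add, ha, hb])
    obtain ⟨S, hS⟩ := exists_finset (ρ a)
    simp [hS, sum_tmul, Finset.smul_sum]
  have e0 : ∀ c, rEps (k := k) (C := C) D (lamf f c) = f c := by
    intro c
    have h0 := congrArg (f : C →ₗ[k] D) (comul_isRightCoaction.rEps (k := k) c)
    have : ∀ z, rEps (k := k) (C := C) D ((f : C →ₗ[k] D).rTensor C z) =
        (f : C →ₗ[k] D) (rEps C z) := by
      intro z
      refine z.induction_on (by simp) (fun a b => ?_)
        (fun _ _ ha hb => by simp only [map_add, ha, hb])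
      simp
    simp only [lamf, corestL, LinearMap.comp_apply]
    rw [this, h0]
    rfl
  have e2 : ∀ z, (rEps (k := k) (C := C) D).lTensor W ((lamf f).lTensor W z) =
      (f : C →ₗ[k] D).lTensor W z := by
    intro z
    refine z.induction_on (by simp) (fun a b => ?_)
      (fun _ _ ha hb => by simp only [map_add, ha, hb])
    simp only [LinearMap.lTensor_tmul, e0]; rfl
  rw [← e1, h, e2]

/-- On `C □_D X`: `ε(c) x₋₁ ⊗ x₀ = f(c) ⊗ x`. -/
theorem coact_lEps (f : C →ₗc[k] D) (l : X →ₗ[k] D ⊗[k] X) (y : Cotensor (rhof f) l) :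
    l (lEps X (incl _ _ y)) = (f : C →ₗ[k] D).rTensor X (incl _ _ y) := by
  have h := congrArg (lEps (k := k) (C := C) (D ⊗[k] X)) (incl_cond _ _ y)
  have e1 : ∀ z, lEps (k := k) (C := C) (D ⊗[k] X) (l.lTensor C z) = l (lEps X z) := by
    intro z
    refine z.induction_on (by simp) (fun a b => ?_)
      (fun _ _ ha hb => by simp only [map_add, ha, hb])
    simp
  have e0 : ∀ c, lEps (k := k) (C := C) D (rhof f c) = f c := by
    intro c
    have h0 : lEps (k := k) C (Coalgebra.comul (R := k) c) = c := by simp [lEps]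
    have : ∀ z, lEps (k := k) (C := C) D ((f : C →ₗ[k] D).lTensor C z) =
        (f : C →ₗ[k] D) (lEps C z) := by
      intro z
      refine z.induction_on (by simp) (fun a b => ?_)
        (fun _ _ ha hb => by simp only [map_add, ha, hb])
      simp
    simp only [rhof, corestR, LinearMap.comp_apply]
    rw [this, h0]
    rfl
  have e2 : ∀ z, lEps (k := k) (C := C) (D ⊗[k] X)
      (TensorProduct.assoc k C D X ((rhof f).rTensor X z)) = (f : C →ₗ[k] D).rTensor X z := by
    intro z
    refine z.induction_on (by simp) (fun a b => ?_)
      (fun _ _ ha hb => by simp only [map_add, ha, hb])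
    have : ∀ t : C ⊗[k] D, lEps (k := k) (C := C) (D ⊗[k] X)
        (TensorProduct.assoc k C D X (t ⊗ₜ[k] b)) = lEps D t ⊗ₜ[k] b := by
      intro t
      refine t.induction_on (by simp) (fun a b => ?_)
        (fun _ _ ha hb => by simp only [map_add, add_tmul, ha, hb])
      simp [smul_tmul']
    simp only [LinearMap.rTensor_tmul, this, e0]; rfl
  rw [← e1, ← h, e2]

/-- The left `C`-coaction of the `C`-bicomodule `C □_D C`. -/
abbrev selfL (f : C →ₗc[k] D) :
    Cotensor (rhof f) (lamf f) →ₗ[k] C ⊗[k] Cotensor (rhof f) (lamf f) :=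
  cotL (rhof f) (lamf f) Coalgebra.comul (rhof_commutes f)

/-- The right `C`-coaction of `W □_D C`, for a right `D`-coaction `ρ` on `W`. -/
abbrev cotC (f : C →ₗc[k] D) (ρ : W →ₗ[k] W ⊗[k] D) :
    Cotensor ρ (lamf f) →ₗ[k] Cotensor ρ (lamf f) ⊗[k] C :=
  cotR ρ (lamf f) Coalgebra.comul (lamf_commutes f)

theorem rEps_comul (z : W ⊗[k] C) : (rEps (C := C) W).rTensor C
    ((TensorProduct.assoc k W C C).symm
      ((Coalgebra.comul (R := k) (A := C)).lTensor W z)) = z := by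
  refine z.induction_on (by simp) (fun a b => ?_)
    (fun _ _ ha hb => by simp only [map_add, ha, hb])
  have h0 : lEps (k := k) C (Coalgebra.comul (R := k) b) = b := by simp [lEps]
  have h1 := congrArg (fun c => a ⊗ₜ[k] c) h0
  obtain ⟨S, hS⟩ := exists_finset (Coalgebra.comul (R := k) (A := C) b)
  simp only [hS, map_sum, tmul_sum, lEps_tmul, LinearMap.lTensor_tmul,
    assoc_symm_tmul, LinearMap.rTensor_tmul, rEps_tmul, smul_tmul] at h1 ⊢
  exact h1

theorem lEps_comul (z : C ⊗[k] W) : (lEps (C := C) W).lTensor C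
    (TensorProduct.assoc k C C W ((Coalgebra.comul (R := k) (A := C)).rTensor W z)) = z := by
  refine z.induction_on (by simp) (fun a b => ?_)
    (fun _ _ ha hb => by simp only [map_add, ha, hb])
  have h0 : rEps (k := k) C (Coalgebra.comul (R := k) a) = a := by simp [rEps]
  have h1 := congrArg (fun c => c ⊗ₜ[k] b) h0
  obtain ⟨S, hS⟩ := exists_finset (Coalgebra.comul (R := k) (A := C) a)
  simp only [hS, map_sum, sum_tmul, lEps_tmul, LinearMap.lTensor_tmul,
    assoc_tmul, LinearMap.rTensor_tmul, rEps_tmul, smul_tmul] at h1 ⊢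
  exact h1

theorem comul_lEps (f : C →ₗc[k] D) (b : Cotensor (rhof f) (lamf f)) :
    Coalgebra.comul (R := k) (lEps C (incl (rhof f) (lamf f) b)) =
      (lEps C ∘ₗ incl (rhof f) (lamf f)).rTensor C (cotC f (rhof f) b) := by
  rw [LinearMap.rTensor_comp, LinearMap.comp_apply, cotR_spec]
  generalize incl (rhof f) (lamf f) b = z
  refine z.induction_on (by simp) (fun a b => ?_)
    (fun _ _ ha hb => by simp only [map_add, ha, hb])
  obtain ⟨S, hS⟩ := exists_finset (Coalgebra.comul (R := k) (A := C) b)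
  simp [hS, tmul_sum, Finset.smul_sum, smul_tmul']

theorem selfL_lEps (f : C →ₗc[k] D) (a : Cotensor (rhof f) (lamf f)) :
    (lEps C ∘ₗ incl (rhof f) (lamf f)).lTensor C (selfL f a) = incl (rhof f) (lamf f) a := by
  rw [LinearMap.lTensor_comp_apply, cotL_spec, lEps_comul]

/-- The action `(W □_D C) □_C (C □_D C) ≅ W □_D C □_D C → W □_D C`, the second arrow being
`id ⊗ ε ⊗ id`. As the isomorphism is induced by `ε ⊗ id : C □_C C ≅ C`, the composite is
`(w ⊗ c) ⊗ (c' ⊗ c'') ↦ ε(c) ε(c') w ⊗ c''`. -/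
def cotAct (f : C →ₗc[k] D) (ρ : W →ₗ[k] W ⊗[k] D) :
    Cotensor (cotC f ρ) (selfL f) →ₗ[k] Cotensor ρ (lamf f) :=
  intoCot ρ (lamf f) (TensorProduct.map (rEps W ∘ₗ incl ρ (lamf f))
    (lEps C ∘ₗ incl (rhof f) (lamf f)) ∘ₗ incl (cotC f ρ) (selfL f)) (by
      intro x
      simp only [LinearMap.comp_apply]
      have h := incl_cond _ _ x
      -- the common target of the two sides of the cotensor condition over `C`
      let T : Cotensor ρ (lamf f) ⊗[k] (C ⊗[k] Cotensor (rhof f) (lamf f)) →ₗ[k]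
          W ⊗[k] (D ⊗[k] C) :=
        TensorProduct.map (rEps W ∘ₗ incl ρ (lamf f))
          (TensorProduct.map (f : C →ₗ[k] D) (lEps C ∘ₗ incl (rhof f) (lamf f)))
      have h1 := congrArg T h
      have e1 : ∀ z, T (TensorProduct.assoc k _ C _ ((cotC f ρ).rTensor _ z)) =
          TensorProduct.assoc k W D C (ρ.rTensor C (TensorProduct.map (rEps W ∘ₗ incl ρ (lamf f))
            (lEps C ∘ₗ incl (rhof f) (lamf f)) z)) := by
        intro z
        refine z.induction_on (by simp) (fun a b => ?_)
          (fun _ _ ha hb => by simp only [map_add, ha, hb])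
        have e3 : ∀ t : Cotensor ρ (lamf f) ⊗[k] C,
            T (TensorProduct.assoc k _ C _ (t ⊗ₜ[k] b)) =
            TensorProduct.assoc k W D C ((f : C →ₗ[k] D).lTensor W
              ((rEps (C := C) W).rTensor C ((incl ρ (lamf f)).rTensor C t)) ⊗ₜ[k]
                lEps C (incl (rhof f) (lamf f) b)) := by
          intro t
          refine t.induction_on (by simp) (fun a b => ?_)
            (fun _ _ ha hb => by simp only [map_add, add_tmul, ha, hb])
          simp [T]
        simp only [LinearMap.rTensor_tmul, TensorProduct.map_tmul, LinearMap.comp_apply]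
        rw [coact_rEps, e3, cotR_spec, rEps_comul]
      have e2 : ∀ z, T ((selfL f).lTensor _ z) =
          (lamf f).lTensor W (TensorProduct.map (rEps W ∘ₗ incl ρ (lamf f))
            (lEps C ∘ₗ incl (rhof f) (lamf f)) z) := by
        intro z
        refine z.induction_on (by simp) (fun a b => ?_)
          (fun _ _ ha hb => by simp only [map_add, ha, hb])
        have e3 : ∀ t : C ⊗[k] Cotensor (rhof f) (lamf f),
            TensorProduct.map (f : C →ₗ[k] D) (lEps C ∘ₗ incl (rhof f) (lamf f)) t =
            (f : C →ₗ[k] D).rTensor C ((lEps (C := C) C).lTensor C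
              ((incl (rhof f) (lamf f)).lTensor C t)) := by
          intro t
          refine t.induction_on (by simp) (fun a b => ?_)
            (fun _ _ ha hb => by simp only [map_add, ha, hb])
          simp
        simp only [LinearMap.lTensor_tmul, TensorProduct.map_tmul, LinearMap.comp_apply, T]
        rw [coact_lEps, e3, cotL_spec, lEps_comul]
      rw [← e1, ← e2, h1])

theorem cotAct_spec (f : C →ₗc[k] D) (ρ : W →ₗ[k] W ⊗[k] D) (x : Cotensor (cotC f ρ) (selfL f)) :
    incl ρ (lamf f) (cotAct f ρ x) = TensorProduct.map (rEps W ∘ₗ incl ρ (lamf f))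
      (lEps C ∘ₗ incl (rhof f) (lamf f)) (incl (cotC f ρ) (selfL f) x) := rfl

theorem self_commutes (f : C →ₗc[k] D) : Commutes (selfL f) (cotC f (rhof f)) :=
  cot_commutes _ _ _ _ _ _

theorem cotAct_rColinear (f : C →ₗc[k] D) (ρ : W →ₗ[k] W ⊗[k] D) :
    RColinear (cotR (cotC f ρ) (selfL f) (cotC f (rhof f)) (self_commutes f)) (cotC f ρ)
      (cotAct f ρ) := by
  intro x
  apply rTensor_inj _ (incl_injective ρ (lamf f))
  have e0 : ∀ z, (incl ρ (lamf f)).rTensor C ((cotAct f ρ).rTensor C z) =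
      (TensorProduct.map (rEps W ∘ₗ incl ρ (lamf f)) (lEps C ∘ₗ incl (rhof f) (lamf f))).rTensor C
        ((incl (cotC f ρ) (selfL f)).rTensor C z) := by
    intro z
    refine z.induction_on (by simp) (fun a b => ?_)
      (fun _ _ ha hb => by simp only [map_add, ha, hb])
    simp only [LinearMap.rTensor_tmul, cotAct_spec]
  have e2 : ∀ z, (TensorProduct.assoc k W C C).symm
      ((Coalgebra.comul (R := k) (A := C)).lTensor W (TensorProduct.map (rEps W ∘ₗ incl ρ (lamf f))
        (lEps C ∘ₗ incl (rhof f) (lamf f)) z)) =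
      (TensorProduct.map (rEps W ∘ₗ incl ρ (lamf f)) (lEps C ∘ₗ incl (rhof f) (lamf f))).rTensor C
        ((TensorProduct.assoc k _ _ C).symm ((cotC f (rhof f)).lTensor _ z)) := by
    intro z
    refine z.induction_on (by simp) (fun a b => ?_)
      (fun _ _ ha hb => by simp only [map_add, ha, hb])
    simp only [TensorProduct.map_tmul, LinearMap.lTensor_tmul, LinearMap.comp_apply]
    rw [comul_lEps]
    obtain ⟨S, hS⟩ := exists_finset (cotC f (rhof f) b)
    simp [hS, tmul_sum]
  rw [e0, cotR_spec, cotR_spec, cotAct_spec, e2]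

theorem cotAct_lColinear (f : C →ₗc[k] D) (ρ : W →ₗ[k] W ⊗[k] D) (m : W →ₗ[k] E ⊗[k] W)
    (hm : Commutes m ρ) :
    LColinear (cotL (cotC f ρ) (selfL f) (cotL ρ (lamf f) m hm) (cot_commutes _ _ _ _ _ _))
      (cotL ρ (lamf f) m hm) (cotAct f ρ) := by
  intro x
  apply lTensor_inj _ (incl_injective ρ (lamf f))
  have e0 : ∀ z, (incl ρ (lamf f)).lTensor E ((cotAct f ρ).lTensor E z) =
      (TensorProduct.map (rEps W ∘ₗ incl ρ (lamf f)) (lEps C ∘ₗ incl (rhof f) (lamf f))).lTensor E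
        ((incl (cotC f ρ) (selfL f)).lTensor E z) := by
    intro z
    refine z.induction_on (by simp) (fun a b => ?_)
      (fun _ _ ha hb => by simp only [map_add, ha, hb])
    simp only [LinearMap.lTensor_tmul, cotAct_spec]
  have e1 : ∀ b, m (rEps W (incl ρ (lamf f) b)) =
      (rEps W ∘ₗ incl ρ (lamf f)).lTensor E (cotL ρ (lamf f) m hm b) := by
    intro b
    rw [LinearMap.lTensor_comp, LinearMap.comp_apply, cotL_spec]
    generalize incl ρ (lamf f) b = z
    refine z.induction_on (by simp) (fun a b => ?_)
      (fun _ _ ha hb => by simp only [map_add, ha, hb])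
    obtain ⟨S, hS⟩ := exists_finset (m a)
    simp [hS, sum_tmul, Finset.smul_sum]
  have e2 : ∀ z, TensorProduct.assoc k E W C (m.rTensor C
      (TensorProduct.map (rEps W ∘ₗ incl ρ (lamf f)) (lEps C ∘ₗ incl (rhof f) (lamf f)) z)) =
      (TensorProduct.map (rEps W ∘ₗ incl ρ (lamf f)) (lEps C ∘ₗ incl (rhof f) (lamf f))).lTensor E
        (TensorProduct.assoc k E _ _ ((cotL ρ (lamf f) m hm).rTensor _ z)) := by
    intro z
    refine z.induction_on (by simp) (fun a b => ?_)
      (fun _ _ ha hb => by simp only [map_add, ha, hb])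
    simp only [TensorProduct.map_tmul, LinearMap.rTensor_tmul, LinearMap.comp_apply]
    rw [e1]
    obtain ⟨S, hS⟩ := exists_finset (cotL ρ (lamf f) m hm a)
    simp [hS, sum_tmul]
  rw [e0, cotL_spec, cotL_spec, cotAct_spec, e2]

theorem cotAct_assoc (f : C →ₗc[k] D) (ρ : W →ₗ[k] W ⊗[k] D)
    (x : Cotensor (cotR (cotC f ρ) (selfL f) (cotC f (rhof f)) (self_commutes f)) (selfL f)) :
    cotAct f ρ (cotMap (cotAct f ρ) LinearMap.id (cotAct_rColinear f ρ) (LColinear.id _) x) =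
      cotAct f ρ (cotMap LinearMap.id (cotAct f (rhof f)) (RColinear.id _)
        (cotAct_lColinear f (rhof f) Coalgebra.comul (rhof_commutes f))
        (cotAssoc (cotC f ρ) (selfL f) (cotC f (rhof f)) (self_commutes f) (selfL f) x)) := by
  apply incl_injective
  have hε : ∀ z : C ⊗[k] C, Coalgebra.counit (R := k) (lEps (k := k) C z) =
      Coalgebra.counit (R := k) (rEps (k := k) C z) := by
    intro z
    refine z.induction_on (by simp) (fun a b => ?_)
      (fun _ _ ha hb => by simp only [map_add, ha, hb])
    simp [mul_comm]
  have e1 : ∀ z, rEps (k := k) (C := C) W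
      (TensorProduct.map (rEps W ∘ₗ incl ρ (lamf f)) (lEps C ∘ₗ incl (rhof f) (lamf f)) z) =
      TensorProduct.rid k W (TensorProduct.map (rEps W ∘ₗ incl ρ (lamf f))
        (Coalgebra.counit (R := k) ∘ₗ rEps C ∘ₗ incl (rhof f) (lamf f)) z) := by
    intro z
    refine z.induction_on (by simp) (fun a b => ?_)
      (fun _ _ ha hb => by simp only [map_add, ha, hb])
    simp [hε]
  have e2 : ∀ z, lEps (k := k) (C := C) C
      (TensorProduct.map (rEps C ∘ₗ incl (rhof f) (lamf f))
        (lEps C ∘ₗ incl (rhof f) (lamf f)) z) =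
      TensorProduct.lid k C (TensorProduct.map (Coalgebra.counit (R := k) ∘ₗ rEps C ∘ₗ
        incl (rhof f) (lamf f)) (lEps C ∘ₗ incl (rhof f) (lamf f)) z) := by
    intro z
    refine z.induction_on (by simp) (fun a b => ?_)
      (fun _ _ ha hb => by simp only [map_add, ha, hb])
    simp
  let G : Cotensor ρ (lamf f) ⊗[k] (Cotensor (rhof f) (lamf f) ⊗[k] Cotensor (rhof f) (lamf f))
      →ₗ[k] W ⊗[k] C :=
    TensorProduct.map (rEps W ∘ₗ incl ρ (lamf f)) ((TensorProduct.lid k C).toLinearMap ∘ₗ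
      TensorProduct.map (Coalgebra.counit (R := k) ∘ₗ rEps C ∘ₗ incl (rhof f) (lamf f))
        (lEps C ∘ₗ incl (rhof f) (lamf f)))
  have e3 : ∀ z, TensorProduct.map (rEps W ∘ₗ incl ρ (lamf f))
      (lEps C ∘ₗ incl (rhof f) (lamf f)) (TensorProduct.map (cotAct f ρ) LinearMap.id z) =
      G (TensorProduct.assoc k _ _ _ ((incl (cotC f ρ) (selfL f)).rTensor _ z)) := by
    intro z
    refine z.induction_on (by simp) (fun a b => ?_)
      (fun _ _ ha hb => by simp only [map_add, ha, hb])
    simp only [TensorProduct.map_tmul, LinearMap.comp_apply, LinearMap.rTensor_tmul,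
      LinearMap.id_apply, cotAct_spec, e1]
    generalize incl (cotC f ρ) (selfL f) a = z
    refine z.induction_on (by simp) (fun a b => ?_)
      (fun _ _ ha hb => by simp only [map_add, add_tmul, ha, hb])
    simp [G, smul_tmul]
  have e4 : ∀ z, TensorProduct.map (rEps W ∘ₗ incl ρ (lamf f))
      (lEps C ∘ₗ incl (rhof f) (lamf f))
        (TensorProduct.map LinearMap.id (cotAct f (rhof f)) z) =
      G ((incl (cotC f (rhof f)) (selfL f)).lTensor _ z) := by
    intro z
    refine z.induction_on (by simp) (fun a b => ?_)
      (fun _ _ ha hb => by simp only [map_add, ha, hb])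
    simp only [TensorProduct.map_tmul, LinearMap.comp_apply, LinearMap.lTensor_tmul,
      LinearMap.id_apply, cotAct_spec, e2, G]
    rfl
  rw [cotAct_spec, cotAct_spec, coe_cotMap, coe_cotMap, e3, e4, cotAssoc_spec]

/-- The coaction of a right `C`-comodule `V` as a map `V → V □_D C`. -/
def unitMap (f : C →ₗc[k] D) (ρ : V →ₗ[k] V ⊗[k] C) (hρ : IsRightCoaction ρ) :
    V →ₗ[k] Cotensor (corestR f ρ) (lamf f) :=
  intoCot _ _ ρ (by
    intro x
    have h := congrArg (((f : C →ₗ[k] D).rTensor C).lTensor V) (hρ.coassoc x)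
    have e1 : ∀ z, TensorProduct.assoc k V D C ((corestR f ρ).rTensor C z) =
        ((f : C →ₗ[k] D).rTensor C).lTensor V (TensorProduct.assoc k V C C (ρ.rTensor C z)) := by
      intro z
      refine z.induction_on (by simp) (fun a b => ?_)
        (fun _ _ ha hb => by simp only [map_add, ha, hb])
      obtain ⟨S, hS⟩ := exists_finset (ρ a)
      simp [corestR, hS, sum_tmul]
    rw [e1, h, ← LinearMap.lTensor_comp_apply]
    rfl)

theorem unitMap_spec (f : C →ₗc[k] D) (ρ : V →ₗ[k] V ⊗[k] C) (hρ : IsRightCoaction ρ) (x : V) :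
    incl _ _ (unitMap f ρ hρ x) = ρ x := rfl

theorem unitMap_rColinear (f : C →ₗc[k] D) (ρ : V →ₗ[k] V ⊗[k] C) (hρ : IsRightCoaction ρ) :
    RColinear ρ (cotC f (corestR f ρ)) (unitMap f ρ hρ) := by
  intro x
  apply rTensor_inj _ (incl_injective _ _)
  rw [cotR_spec, unitMap_spec, ← hρ.coassoc, LinearEquiv.symm_apply_apply,
    ← LinearMap.rTensor_comp_apply]
  rfl

/-- The unit `C → C □_D C`, given by the comultiplication. -/
abbrev selfUnit (f : C →ₗc[k] D) : C →ₗ[k] Cotensor (rhof f) (lamf f) :=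
  unitMap f (Coalgebra.comul (R := k) (A := C)) comul_isRightCoaction

theorem selfUnit_lColinear (f : C →ₗc[k] D) :
    LColinear (Coalgebra.comul (R := k) (A := C)) (selfL f) (selfUnit f) := by
  intro x
  apply lTensor_inj _ (incl_injective _ _)
  rw [cotL_spec, unitMap_spec, comul_isRightCoaction.coassoc,
    ← LinearMap.lTensor_comp_apply]
  rfl

theorem cotAct_unit (f : C →ₗc[k] D) (ρ : W →ₗ[k] W ⊗[k] D)
    (x : Cotensor (cotC f ρ) (Coalgebra.comul (R := k) (A := C))) :
    cotAct f ρ (cotMap LinearMap.id (selfUnit f) (RColinear.id _) (selfUnit_lColinear f) x) =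
      rEps _ (incl _ _ x) := by
  apply incl_injective
  have h := congrArg (TensorProduct.map (rEps W ∘ₗ incl ρ (lamf f)) (rEps (k := k) (C := C) C))
    (incl_cond _ _ x)
  have e1 : ∀ z, TensorProduct.map (rEps W ∘ₗ incl ρ (lamf f)) (lEps C ∘ₗ incl (rhof f) (lamf f))
      (TensorProduct.map LinearMap.id (selfUnit f) z) =
      TensorProduct.map (rEps W ∘ₗ incl ρ (lamf f)) (rEps (k := k) (C := C) C)
        ((Coalgebra.comul (R := k) (A := C)).lTensor _ z) := by
    intro z
    refine z.induction_on (by simp) (fun a b => ?_)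
      (fun _ _ ha hb => by simp only [map_add, ha, hb])
    have h0 : rEps (k := k) C (Coalgebra.comul (R := k) b) = b := by simp [rEps]
    have h1 : lEps (k := k) C (Coalgebra.comul (R := k) b) = b := by simp [lEps]
    simp [unitMap_spec, h0, h1]
  have e2 : ∀ z, TensorProduct.map (rEps W ∘ₗ incl ρ (lamf f)) (rEps (k := k) (C := C) C)
        (TensorProduct.assoc k _ C C ((cotC f ρ).rTensor C z)) =
      incl ρ (lamf f) (rEps _ z) := by
    intro z
    refine z.induction_on (by simp) (fun a b => ?_)
      (fun _ _ ha hb => by simp only [map_add, ha, hb])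
    have e3 : ∀ t, TensorProduct.map (rEps W ∘ₗ incl ρ (lamf f)) (rEps (k := k) (C := C) C)
        (TensorProduct.assoc k _ C C (t ⊗ₜ[k] b)) = Coalgebra.counit (R := k) b •
          (rEps (C := C) W).rTensor C ((incl ρ (lamf f)).rTensor C t) := by
      intro t
      refine t.induction_on (by simp) (fun a b => ?_)
        (fun _ _ ha hb => by simp only [map_add, add_tmul, smul_add, ha, hb])
      simp
    rw [LinearMap.rTensor_tmul, e3, cotR_spec, rEps_comul]
    simp
  rw [cotAct_spec, coe_cotMap, e1, ← h, e2]

theorem cotAct_unit_left (f : C →ₗc[k] D)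
    (x : Cotensor (Coalgebra.comul (R := k) (A := C)) (selfL f)) :
    cotAct f (rhof f) (cotMap (selfUnit f) LinearMap.id
      (unitMap_rColinear f _ comul_isRightCoaction) (LColinear.id _) x) =
      lEps _ (incl _ _ x) := by
  apply incl_injective
  have h := congrArg (TensorProduct.map (LinearMap.id : C →ₗ[k] C) (lEps (k := k) (C := C) C ∘ₗ
    incl (rhof f) (lamf f)) ∘ₗ lEps (k := k) (C := C) (C ⊗[k] Cotensor (rhof f) (lamf f)))
    (incl_cond _ _ x)
  have e1 : ∀ z, TensorProduct.map (rEps C ∘ₗ incl (rhof f) (lamf f))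
      (lEps C ∘ₗ incl (rhof f) (lamf f))
      (TensorProduct.map (selfUnit f) LinearMap.id z) =
      (TensorProduct.map (LinearMap.id : C →ₗ[k] C) (lEps (k := k) (C := C) C ∘ₗ
        incl (rhof f) (lamf f)) ∘ₗ lEps (k := k) (C := C) (C ⊗[k] Cotensor (rhof f) (lamf f)))
        (TensorProduct.assoc k C C _ ((Coalgebra.comul (R := k) (A := C)).rTensor _ z)) := by
    intro z
    refine z.induction_on (by simp) (fun a b => ?_)
      (fun _ _ ha hb => by simp only [map_add, ha, hb])
    have h0 : rEps (k := k) C (Coalgebra.comul (R := k) a) = a := by simp [rEps]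
    have h1 : lEps (k := k) C (Coalgebra.comul (R := k) a) = a := by simp [lEps]
    have e3 : ∀ t : C ⊗[k] C, lEps (k := k) (C := C) (C ⊗[k] Cotensor (rhof f) (lamf f))
        (TensorProduct.assoc k C C _ (t ⊗ₜ[k] b)) = lEps (k := k) C t ⊗ₜ[k] b := by
      intro t
      refine t.induction_on (by simp) (fun a b => ?_)
        (fun _ _ ha hb => by simp only [map_add, add_tmul, ha, hb])
      simp [smul_tmul']
    simp [unitMap_spec, h0, e3, h1]
  have e2 : ∀ z, (TensorProduct.map (LinearMap.id : C →ₗ[k] C) (lEps (k := k) (C := C) C ∘ₗ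
        incl (rhof f) (lamf f)) ∘ₗ lEps (k := k) (C := C) (C ⊗[k] Cotensor (rhof f) (lamf f)))
        ((selfL f).lTensor C z) = incl (rhof f) (lamf f) (lEps _ z) := by
    intro z
    refine z.induction_on (by simp) (fun a b => ?_)
      (fun _ _ ha hb => by simp only [map_add, ha, hb])
    simp only [LinearMap.lTensor_tmul, LinearMap.comp_apply, lEps_tmul, map_smul]
    exact congrArg _ (selfL_lEps f b)
  rw [cotAct_spec, coe_cotMap, e1, h, e2]

/-- The coaction of a right `C`-comodule `V` as a map `V → V □_C C`. -/
def toCot (ρ : V →ₗ[k] V ⊗[k] C) (hρ : IsRightCoaction ρ) :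
    V →ₗ[k] Cotensor ρ (Coalgebra.comul (R := k) (A := C)) :=
  intoCot _ _ ρ hρ.coassoc

theorem toCot_rColinear (f : C →ₗc[k] D) (ρ : V →ₗ[k] V ⊗[k] C) (hρ : IsRightCoaction ρ) :
    RColinear (corestR f ρ) (cotR ρ Coalgebra.comul (rhof f) (rhof_commutes f))
      (toCot ρ hρ) := by
  intro x
  apply rTensor_inj _ (incl_injective _ _)
  rw [cotR_spec, ← LinearMap.rTensor_comp_apply]
  change _ = ρ.rTensor D ((f : C →ₗ[k] D).lTensor V (ρ x))
  change (TensorProduct.assoc k V C D).symm (((f : C →ₗ[k] D).lTensor C ∘ₗ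
    Coalgebra.comul (R := k) (A := C)).lTensor V (ρ x)) = _
  rw [LinearMap.lTensor_comp_apply, ← hρ.coassoc]
  generalize ρ x = z
  refine z.induction_on (by simp) (fun a b => ?_)
    (fun _ _ ha hb => by simp only [map_add, ha, hb])
  obtain ⟨S, hS⟩ := exists_finset (ρ a)
  simp [hS, sum_tmul]

/-- The isomorphism `V □_D C ≅ (V □_C C) □_D C ≅ V □_C (C □_D C)`, for a right `C`-comodule `V`. -/
def expand (f : C →ₗc[k] D) (ρ : V →ₗ[k] V ⊗[k] C) (hρ : IsRightCoaction ρ) :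
    Cotensor (corestR f ρ) (lamf f) →ₗ[k] Cotensor ρ (selfL f) :=
  cotAssoc ρ Coalgebra.comul (rhof f) (rhof_commutes f) (lamf f) ∘ₗ
    cotMap (toCot ρ hρ) LinearMap.id (toCot_rColinear f ρ hρ) (LColinear.id _)

theorem expand_spec (f : C →ₗc[k] D) (ρ : V →ₗ[k] V ⊗[k] C) (hρ : IsRightCoaction ρ)
    (x : Cotensor (corestR f ρ) (lamf f)) :
    (incl (rhof f) (lamf f)).lTensor V (incl _ _ (expand f ρ hρ x)) =
      TensorProduct.assoc k V C C (ρ.rTensor C (incl _ _ x)) := by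
  rw [expand, LinearMap.comp_apply, cotAssoc_spec, coe_cotMap]
  generalize incl (corestR f ρ) (lamf f) x = z
  refine z.induction_on (by simp) (fun a b => ?_)
    (fun _ _ ha hb => by simp only [map_add, ha, hb])
  rfl

/-- The inverse `v ⊗ (c ⊗ c') ↦ ε(c) v ⊗ c'` of `expand`. -/
def contract (f : C →ₗc[k] D) (ρ : V →ₗ[k] V ⊗[k] C) :
    Cotensor ρ (selfL f) →ₗ[k] Cotensor (corestR f ρ) (lamf f) :=
  intoCot _ _ ((lEps C ∘ₗ incl (rhof f) (lamf f)).lTensor V ∘ₗ incl ρ (selfL f)) (by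
    intro y
    have h := congrArg ((TensorProduct.map (f : C →ₗ[k] D)
      (lEps C ∘ₗ incl (rhof f) (lamf f))).lTensor V) (incl_cond _ _ y)
    have e1 : ∀ z, (TensorProduct.map (f : C →ₗ[k] D)
        (lEps C ∘ₗ incl (rhof f) (lamf f))).lTensor V
          (TensorProduct.assoc k V C _ (ρ.rTensor _ z)) =
        TensorProduct.assoc k V D C ((corestR f ρ).rTensor C
          ((lEps C ∘ₗ incl (rhof f) (lamf f)).lTensor V z)) := by
      intro z
      refine z.induction_on (by simp) (fun a b => ?_)
        (fun _ _ ha hb => by simp only [map_add, ha, hb])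
      obtain ⟨S, hS⟩ := exists_finset (ρ a)
      simp [corestR, hS, sum_tmul]
    have e2 : ∀ z, (TensorProduct.map (f : C →ₗ[k] D)
        (lEps C ∘ₗ incl (rhof f) (lamf f))).lTensor V ((selfL f).lTensor V z) =
        (lamf f).lTensor V ((lEps C ∘ₗ incl (rhof f) (lamf f)).lTensor V z) := by
      intro z
      refine z.induction_on (by simp) (fun a b => ?_)
        (fun _ _ ha hb => by simp only [map_add, ha, hb])
      simp only [LinearMap.lTensor_tmul]
      rw [← LinearMap.rTensor_comp_lTensor, LinearMap.comp_apply, selfL_lEps,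
        LinearMap.comp_apply, coact_lEps]
    rw [LinearMap.comp_apply, ← e1, ← e2, h])

theorem expand_contract (f : C →ₗc[k] D) (ρ : V →ₗ[k] V ⊗[k] C) (hρ : IsRightCoaction ρ)
    (y : Cotensor ρ (selfL f)) : expand f ρ hρ (contract f ρ y) = y := by
  apply incl_injective
  apply lTensor_inj _ (incl_injective (rhof f) (lamf f))
  have e1 : ∀ z, TensorProduct.assoc k V C C (ρ.rTensor C
      ((lEps C ∘ₗ incl (rhof f) (lamf f)).lTensor V z)) =
      ((lEps C ∘ₗ incl (rhof f) (lamf f)).lTensor C).lTensor V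
        (TensorProduct.assoc k V C _ (ρ.rTensor _ z)) := by
    intro z
    refine z.induction_on (by simp) (fun a b => ?_)
      (fun _ _ ha hb => by simp only [map_add, ha, hb])
    obtain ⟨S, hS⟩ := exists_finset (ρ a)
    simp [hS, sum_tmul]
  have e2 : (lEps C ∘ₗ incl (rhof f) (lamf f)).lTensor C ∘ₗ selfL f = incl (rhof f) (lamf f) :=
    LinearMap.ext (selfL_lEps f)
  rw [expand_spec, contract, incl_intoCot, LinearMap.comp_apply, e1, incl_cond,
    ← LinearMap.lTensor_comp_apply, e2]

end Raw

/-- Right comodules over the coalgebra `C`. -/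
structure RComod (k : Type u) [Field k] (C : Type v) [AddCommGroup C] [Module k C]
    [Coalgebra k C] where
  /-- the underlying vector space -/
  carrier : Type v
  [grp : AddCommGroup carrier]
  [mod : Module k carrier]
  /-- the coaction -/
  ρ : carrier →ₗ[k] carrier ⊗[k] C
  isCo : IsRightCoaction ρ

attribute [instance] RComod.grp RComod.mod

/-- Left comodules over the coalgebra `C`. -/
structure LComod (k : Type u) [Field k] (C : Type v) [AddCommGroup C] [Module k C]
    [Coalgebra k C] where
  /-- the underlying vector space -/
  carrier : Type v
  [grp : AddCommGroup carrier]
  [mod : Module k carrier]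
  /-- the coaction -/
  l : carrier →ₗ[k] C ⊗[k] carrier
  isCo : IsLeftCoaction l

attribute [instance] LComod.grp LComod.mod

/-- `(C, D)`-bicomodules. -/
structure Bicomod (k : Type u) [Field k] (C D : Type v) [AddCommGroup C] [Module k C]
    [Coalgebra k C] [AddCommGroup D] [Module k D] [Coalgebra k D] where
  /-- the underlying vector space -/
  carrier : Type v
  [grp : AddCommGroup carrier]
  [mod : Module k carrier]
  /-- the left coaction -/
  l : carrier →ₗ[k] C ⊗[k] carrier
  isCoL : IsLeftCoaction l
  /-- the right coaction -/
  ρ : carrier →ₗ[k] carrier ⊗[k] D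
  isCoR : IsRightCoaction ρ
  comm : Commutes l ρ

attribute [instance] Bicomod.grp Bicomod.mod

section Cats

variable {k : Type u} [Field k] {C D : Type v} [AddCommGroup C] [Module k C] [Coalgebra k C]
  [AddCommGroup D] [Module k D] [Coalgebra k D]

/-- Morphisms of right comodules: colinear maps. -/
@[ext]
structure RComod.Hom (V W : RComod k C) where
  /-- the underlying linear map -/
  lin : V.carrier →ₗ[k] W.carrier
  colin : RColinear V.ρ W.ρ lin

/-- The category `M^C` of right `C`-comodules. -/
instance : Category (RComod k C) where
  Hom := RComod.Hom
  id V := ⟨LinearMap.id, RColinear.id _⟩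
  comp g h := ⟨h.lin ∘ₗ g.lin, fun x => by
    rw [LinearMap.comp_apply, h.colin, g.colin, LinearMap.rTensor_comp_apply]⟩

@[ext]
theorem RComod.hom_ext {V W : RComod k C} {g h : V ⟶ W} (e : g.lin = h.lin) : g = h :=
  RComod.Hom.ext e

@[simp]
theorem RComod.id_lin (V : RComod k C) : RComod.Hom.lin (𝟙 V) = LinearMap.id := rfl

@[simp]
theorem RComod.comp_lin {U V W : RComod k C} (g : U ⟶ V) (h : V ⟶ W) :
    (g ≫ h).lin = h.lin ∘ₗ g.lin := rfl

/-- Unital associative algebras internal to the monoidal category of `C`-bicomodules, with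
`□_C` as tensor product and `C` as unit object. -/
structure IntAlg (k : Type u) [Field k] (C : Type v) [AddCommGroup C] [Module k C]
    [Coalgebra k C] where
  /-- the underlying bicomodule -/
  A : Bicomod k C C
  /-- the multiplication `A □_C A → A` -/
  mul : Cotensor A.ρ A.l →ₗ[k] A.carrier
  mul_left : LColinear (cotL A.ρ A.l A.l A.comm) A.l mul
  mul_right : RColinear (cotR A.ρ A.l A.ρ A.comm) A.ρ mul
  /-- the unit `C → A` -/
  one : C →ₗ[k] A.carrier
  one_left : LColinear Coalgebra.comul A.l one
  one_right : RColinear Coalgebra.comul A.ρ one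
  mul_assoc : ∀ x : Cotensor (cotR A.ρ A.l A.ρ A.comm) A.l,
    mul (cotMap mul LinearMap.id mul_right (LColinear.id _) x) =
      mul (cotMap LinearMap.id mul (RColinear.id _) mul_left (cotAssoc A.ρ A.l A.ρ A.comm A.l x))
  /-- the left unit law, through `ε ⊗ id : C □_C A ≅ A` -/
  one_mul : ∀ x : Cotensor (Coalgebra.comul (R := k) (A := C)) A.l,
    mul (cotMap one LinearMap.id one_right (LColinear.id _) x) = lEps A.carrier (incl _ _ x)
  /-- the right unit law, through `id ⊗ ε : A □_C C ≅ A` -/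
  mul_one : ∀ x : Cotensor A.ρ (Coalgebra.comul (R := k) (A := C)),
    mul (cotMap LinearMap.id one (RColinear.id _) one_left x) = rEps A.carrier (incl _ _ x)

/-- Right modules over an algebra `A` in `C`-bicomodules: right `C`-comodules `V` with an
associative and unital action `V □_C A → V` in right `C`-comodules. -/
structure RMod (A : IntAlg k C) where
  /-- the underlying comodule -/
  V : RComod k C
  /-- the action -/
  act : Cotensor V.ρ A.A.l →ₗ[k] V.carrier
  act_colin : RColinear (cotR V.ρ A.A.l A.A.ρ A.A.comm) V.ρ act
  act_assoc : ∀ x : Cotensor (cotR V.ρ A.A.l A.A.ρ A.A.comm) A.A.l,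
    act (cotMap act LinearMap.id act_colin (LColinear.id _) x) =
      act (cotMap LinearMap.id A.mul (RColinear.id _) A.mul_left
        (cotAssoc V.ρ A.A.l A.A.ρ A.A.comm A.A.l x))
  act_one : ∀ x : Cotensor V.ρ (Coalgebra.comul (R := k) (A := C)),
    act (cotMap LinearMap.id A.one (RColinear.id _) A.one_left x) = rEps V.carrier (incl _ _ x)

/-- Morphisms of right modules: comodule maps commuting with the actions. -/
@[ext]
structure RMod.Hom {A : IntAlg k C} (M N : RMod A) where
  /-- the underlying comodule map -/
  hom : M.V ⟶ N.V
  equivariant : ∀ x : Cotensor M.V.ρ A.A.l,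
    hom.lin (M.act x) = N.act (cotMap hom.lin LinearMap.id hom.colin (LColinear.id _) x)

/-- The category `M_A` of right `A`-modules. -/
instance (A : IntAlg k C) : Category (RMod A) where
  Hom := RMod.Hom
  id M := ⟨𝟙 _, fun x => by
    apply congrArg M.act
    apply incl_injective
    simp⟩
  comp g h := ⟨g.hom ≫ h.hom, fun x => by
    change h.hom.lin (g.hom.lin _) = _
    rw [g.equivariant, h.equivariant]
    congr 1
    apply incl_injective
    simp only [coe_cotMap, RComod.comp_lin, TensorProduct.map_map, LinearMap.id_comp]⟩

@[ext]
theorem RMod.hom_ext {A : IntAlg k C} {M N : RMod A} {g h : M ⟶ N}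
    (e : g.hom.lin = h.hom.lin) : g = h :=
  RMod.Hom.ext (RComod.hom_ext e)

@[simp]
theorem RMod.id_hom {A : IntAlg k C} (M : RMod A) : RMod.Hom.hom (𝟙 M) = 𝟙 M.V := rfl

@[simp]
theorem RMod.comp_hom {A : IntAlg k C} {L M N : RMod A} (g : L ⟶ M) (h : M ⟶ N) :
    (g ≫ h).hom = g.hom ≫ h.hom := rfl

/-- `C □_D C` as an algebra in `C`-bicomodules. -/
def selfAlg (f : C →ₗc[k] D) : IntAlg k C where
  A :=
    { carrier := Cotensor (rhof f) (lamf f)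
      l := selfL f
      isCoL := cotL_isLeftCoaction _ _ _ _ comul_isLeftCoaction
      ρ := cotC f (rhof f)
      isCoR := cotR_isRightCoaction _ _ _ _ comul_isRightCoaction
      comm := self_commutes f }
  mul := cotAct f (rhof f)
  mul_left := cotAct_lColinear f (rhof f) Coalgebra.comul (rhof_commutes f)
  mul_right := cotAct_rColinear f (rhof f)
  one := selfUnit f
  one_left := selfUnit_lColinear f
  one_right := unitMap_rColinear f _ comul_isRightCoaction
  mul_assoc := cotAct_assoc f (rhof f)
  one_mul := cotAct_unit_left f
  mul_one := cotAct_unit f (rhof f)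

/-- The right `C`-comodule `W □_D C`. -/
def cotComod (f : C →ₗc[k] D) (W : RComod k D) : RComod k C where
  carrier := Cotensor W.ρ (lamf f)
  ρ := cotC f W.ρ
  isCo := cotR_isRightCoaction _ _ _ _ comul_isRightCoaction

/-- The right `C □_D C`-module `W □_D C`. -/
def cotMod (f : C →ₗc[k] D) (W : RComod k D) : RMod (selfAlg f) where
  V := cotComod f W
  act := cotAct f W.ρ
  act_colin := cotAct_rColinear f W.ρ
  act_assoc := cotAct_assoc f W.ρ
  act_one := cotAct_unit f W.ρ

theorem cotMap_cotC (f : C →ₗc[k] D) {W W' : RComod k D} (g : W ⟶ W') :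
    RColinear (cotC f W.ρ) (cotC f W'.ρ)
      (cotMap g.lin LinearMap.id g.colin (LColinear.id (lamf f))) := by
  intro x
  apply rTensor_inj _ (incl_injective _ _)
  have e1 : ∀ z, (incl W'.ρ (lamf f)).rTensor C
      ((cotMap g.lin LinearMap.id g.colin (LColinear.id (lamf f))).rTensor C z) =
      (TensorProduct.map g.lin LinearMap.id).rTensor C ((incl W.ρ (lamf f)).rTensor C z) := by
    intro z
    refine z.induction_on (by simp) (fun a b => ?_)
      (fun _ _ ha hb => by simp only [map_add, ha, hb])
    simp
  rw [e1, cotR_spec, cotR_spec, coe_cotMap]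
  generalize incl W.ρ (lamf f) x = z
  refine z.induction_on (by simp) (fun a b => ?_)
    (fun _ _ ha hb => by simp only [map_add, ha, hb])
  obtain ⟨S, hS⟩ := exists_finset (Coalgebra.comul (R := k) (A := C) b)
  simp [hS, tmul_sum]

theorem cotMap_equivariant (f : C →ₗc[k] D) {W W' : RComod k D} (g : W ⟶ W')
    (x : Cotensor (cotC f W.ρ) (selfL f)) :
    cotMap g.lin LinearMap.id g.colin (LColinear.id _) (cotAct f W.ρ x) =
      cotAct f W'.ρ (cotMap (cotMap g.lin LinearMap.id g.colin (LColinear.id _)) LinearMap.id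
        (cotMap_cotC f g) (LColinear.id _) x) := by
  apply incl_injective W'.ρ (lamf f)
  have e0 : ∀ z : W.carrier ⊗[k] C, rEps (k := k) W'.carrier
      (TensorProduct.map g.lin LinearMap.id z) = g.lin (rEps W.carrier z) := by
    intro z
    refine z.induction_on (by simp) (fun a b => ?_)
      (fun _ _ ha hb => by simp only [map_add, ha, hb])
    simp
  rw [cotAct_spec, coe_cotMap, coe_cotMap, cotAct_spec]
  generalize incl (cotC f W.ρ) (selfL f) x = z
  refine z.induction_on (by simp) (fun a b => ?_)
    (fun _ _ ha hb => by simp only [map_add, ha, hb])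
  simp [e0]

/-- The functor `- □_D C : M^D → M_{C □_D C}`. -/
def cotFunctor (f : C →ₗc[k] D) : RComod k D ⥤ RMod (selfAlg f) where
  obj W := cotMod f W
  map {W W'} g :=
    { hom := ⟨cotMap g.lin LinearMap.id g.colin (LColinear.id _), cotMap_cotC f g⟩
      equivariant := cotMap_equivariant f g }
  map_id W := by
    apply RMod.hom_ext
    apply LinearMap.ext
    intro x
    apply incl_injective W.ρ (lamf f)
    change TensorProduct.map LinearMap.id LinearMap.id (incl W.ρ (lamf f) x) =
      incl W.ρ (lamf f) x
    rw [TensorProduct.map_id, LinearMap.id_apply]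
  map_comp {U V W} g h := by
    apply RMod.hom_ext
    apply LinearMap.ext
    intro x
    apply incl_injective W.ρ (lamf f)
    change TensorProduct.map (h.lin ∘ₗ g.lin) LinearMap.id (incl U.ρ (lamf f) x) =
      TensorProduct.map h.lin LinearMap.id (TensorProduct.map g.lin LinearMap.id
        (incl U.ρ (lamf f) x))
    simp only [TensorProduct.map_map, LinearMap.id_comp]

/-- The action of a right `C □_D C`-module `N`. -/
def selfAct (f : C →ₗc[k] D) (N : RMod (selfAlg f)) :
    Cotensor N.V.ρ (selfL f) →ₗ[k] N.V.carrier :=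
  N.act

theorem selfAct_rColinear (f : C →ₗc[k] D) (N : RMod (selfAlg f)) :
    RColinear (cotR N.V.ρ (selfL f) (cotC f (rhof f)) (self_commutes f)) N.V.ρ (selfAct f N) :=
  N.act_colin

theorem selfAct_natural (f : C →ₗc[k] D) {M N : RMod (selfAlg f)} (g : M ⟶ N)
    (x : Cotensor M.V.ρ (selfL f)) : g.hom.lin (selfAct f M x) =
      selfAct f N (cotMap g.hom.lin LinearMap.id g.hom.colin (LColinear.id _) x) :=
  g.equivariant x

/-- The action of a right `C □_D C`-module `N`, as a map `N □_D C ≅ N □_C (C □_D C) → N`. -/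
def actD (f : C →ₗc[k] D) (N : RMod (selfAlg f)) :
    Cotensor (corestR f N.V.ρ) (lamf f) →ₗ[k] N.V.carrier :=
  selfAct f N ∘ₗ expand f N.V.ρ N.V.isCo

/-- The map `id ⊗ ε : N □_D C → N`. -/
def epsD (f : C →ₗc[k] D) (N : RMod (selfAlg f)) :
    Cotensor (corestR f N.V.ρ) (lamf f) →ₗ[k] N.V.carrier :=
  rEps N.V.carrier ∘ₗ incl (corestR f N.V.ρ) (lamf f)

/-- The space of coinvariants of `N`: the coequalizer of `actD` and `epsD`. -/
abbrev CoinvSpace (f : C →ₗc[k] D) (N : RMod (selfAlg f)) : Type v :=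
  N.V.carrier ⧸ LinearMap.range (actD f N - epsD f N)

/-- The projection onto the coinvariants. -/
abbrev toCoinv (f : C →ₗc[k] D) (N : RMod (selfAlg f)) : N.V.carrier →ₗ[k] CoinvSpace f N :=
  (LinearMap.range (actD f N - epsD f N)).mkQ

theorem toCoinv_eq (f : C →ₗc[k] D) (N : RMod (selfAlg f))
    (z : Cotensor (corestR f N.V.ρ) (lamf f)) :
    toCoinv f N (actD f N z) = toCoinv f N (epsD f N z) := by
  rw [← sub_eq_zero, ← map_sub]
  simp only [toCoinv, Submodule.mkQ_apply]
  rw [Submodule.Quotient.mk_eq_zero]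
  exact ⟨z, rfl⟩

theorem rl_comm {V V' X Y : Type*} [AddCommGroup V] [Module k V] [AddCommGroup V'] [Module k V']
    [AddCommGroup X] [Module k X] [AddCommGroup Y] [Module k Y] (g : V →ₗ[k] V') (h : X →ₗ[k] Y)
    (z : V ⊗[k] X) : g.rTensor Y (h.lTensor V z) = h.lTensor V' (g.rTensor X z) := by
  rw [← LinearMap.comp_apply, ← LinearMap.comp_apply, LinearMap.lTensor_comp_rTensor,
    LinearMap.rTensor_comp_lTensor]

/-- `C`-colinearity implies `D`-colinearity of the corestrictions. -/
theorem RColinear.corestR (f : C →ₗc[k] D) {V V' : Type v} [AddCommGroup V] [Module k V]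
    [AddCommGroup V'] [Module k V'] {ρ : V →ₗ[k] V ⊗[k] C} {ρ' : V' →ₗ[k] V' ⊗[k] C}
    {g : V →ₗ[k] V'} (h : RColinear ρ ρ' g) : RColinear (corestR f ρ) (corestR f ρ') g := by
  intro x
  change (f : C →ₗ[k] D).lTensor V' (ρ' (g x)) = g.rTensor D ((f : C →ₗ[k] D).lTensor V (ρ x))
  rw [h, rl_comm]

theorem expand_rColinear (f : C →ₗc[k] D) {V : Type v} [AddCommGroup V] [Module k V]
    (ρ : V →ₗ[k] V ⊗[k] C) (hρ : IsRightCoaction ρ) :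
    RColinear (cotC f (CoalgDescent.corestR f ρ))
      (cotR ρ (selfL f) (cotC f (rhof f)) (self_commutes f)) (expand f ρ hρ) := by
  intro x
  apply rTensor_inj _ (incl_injective _ _)
  apply rTensor_inj _ (lTensor_inj _ (incl_injective _ _))
  have e1 : ∀ z, ((incl (rhof f) (lamf f)).lTensor V).rTensor C
      ((incl ρ (selfL f)).rTensor C ((expand f ρ hρ).rTensor C z)) =
      ((TensorProduct.assoc k V C C).toLinearMap ∘ₗ ρ.rTensor C).rTensor C
        ((incl _ _).rTensor C z) := by
    intro z
    refine z.induction_on (by simp) (fun a b => ?_)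
      (fun _ _ ha hb => by simp only [map_add, ha, hb])
    simp [expand_spec]
  have e2 : ∀ z, ((incl (rhof f) (lamf f)).lTensor V).rTensor C
      ((TensorProduct.assoc k V _ C).symm ((cotC f (rhof f)).lTensor V z)) =
      (TensorProduct.assoc k V _ C).symm (((TensorProduct.assoc k C C C).symm.toLinearMap ∘ₗ
        (Coalgebra.comul (R := k) (A := C)).lTensor C).lTensor V
          ((incl (rhof f) (lamf f)).lTensor V z)) := by
    intro z
    refine z.induction_on (by simp) (fun a b => ?_)
      (fun _ _ ha hb => by simp only [map_add, ha, hb])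
    have e3 : ∀ t, ((incl (rhof f) (lamf f)).lTensor V).rTensor C
        ((TensorProduct.assoc k V _ C).symm (a ⊗ₜ[k] t)) =
        (TensorProduct.assoc k V _ C).symm (a ⊗ₜ[k] (incl (rhof f) (lamf f)).rTensor C t) := by
      intro t
      refine t.induction_on (by simp) (fun a b => ?_)
        (fun _ _ ha hb => by simp only [map_add, tmul_add, ha, hb])
      simp
    simp only [LinearMap.lTensor_tmul]
    rw [e3, cotR_spec]
    rfl
  rw [e1, cotR_spec, cotR_spec, e2, expand_spec]
  generalize incl (CoalgDescent.corestR f ρ) (lamf f) x = z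
  refine z.induction_on (by simp) (fun a b => ?_)
    (fun _ _ ha hb => by simp only [map_add, ha, hb])
  obtain ⟨S, hS⟩ := exists_finset (Coalgebra.comul (R := k) (A := C) b)
  obtain ⟨T, hT⟩ := exists_finset (ρ a)
  simp only [hS, hT, map_sum, sum_tmul, tmul_sum, LinearMap.rTensor_tmul,
    LinearMap.lTensor_tmul, TensorProduct.assoc_tmul, TensorProduct.assoc_symm_tmul,
    LinearEquiv.coe_coe, LinearMap.comp_apply]
  first | done | exact Finset.sum_comm

theorem actD_rColinear (f : C →ₗc[k] D) (N : RMod (selfAlg f)) :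
    RColinear (cotC f (corestR f N.V.ρ)) N.V.ρ (actD f N) := by
  intro x
  rw [actD, LinearMap.rTensor_comp_apply, ← expand_rColinear f N.V.ρ N.V.isCo x,
    LinearMap.comp_apply, selfAct_rColinear]

theorem epsD_rColinear (f : C →ₗc[k] D) (N : RMod (selfAlg f)) :
    RColinear (corestR f (cotC f (corestR f N.V.ρ))) (corestR f N.V.ρ) (epsD f N) := by
  intro x
  change corestR f N.V.ρ (rEps _ (incl _ _ x)) = (rEps _ ∘ₗ incl _ _).rTensor D
    ((f : C →ₗ[k] D).lTensor _ (cotC f (corestR f N.V.ρ) x))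
  rw [coact_rEps, rl_comm, LinearMap.rTensor_comp_apply, cotR_spec, rEps_comul]

/-- The right `D`-coaction on the coinvariants, induced by that on `N`. -/
def coinvCoact (f : C →ₗc[k] D) (N : RMod (selfAlg f)) :
    CoinvSpace f N →ₗ[k] CoinvSpace f N ⊗[k] D :=
  (LinearMap.range (actD f N - epsD f N)).liftQ
    ((toCoinv f N).rTensor D ∘ₗ corestR f N.V.ρ) (by
      rintro _ ⟨z, rfl⟩
      rw [LinearMap.mem_ker, LinearMap.sub_apply, map_sub, sub_eq_zero, LinearMap.comp_apply,
        LinearMap.comp_apply, (actD_rColinear f N).corestR f, epsD_rColinear,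
        ← LinearMap.rTensor_comp_apply, ← LinearMap.rTensor_comp_apply]
      congr 2
      exact LinearMap.ext (toCoinv_eq f N))

theorem toCoinv_rColinear (f : C →ₗc[k] D) (N : RMod (selfAlg f)) :
    RColinear (corestR f N.V.ρ) (coinvCoact f N) (toCoinv f N) :=
  fun _ => rfl

/-- The right `D`-comodule of coinvariants. -/
def coinvComod (f : C →ₗc[k] D) (N : RMod (selfAlg f)) : RComod k D where
  carrier := CoinvSpace f N
  ρ := coinvCoact f N
  isCo :=
    { coassoc := fun x => by
        obtain ⟨n, rfl⟩ := Submodule.mkQ_surjective _ x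
        have h := (corestR_isRightCoaction f N.V.isCo).coassoc n
        have h1 := congrArg ((toCoinv f N).rTensor (D ⊗[k] D)) h
        have e1 : ∀ z, TensorProduct.assoc k _ D D ((coinvCoact f N).rTensor D
            ((toCoinv f N).rTensor D z)) = (toCoinv f N).rTensor (D ⊗[k] D)
              (TensorProduct.assoc k _ D D ((corestR f N.V.ρ).rTensor D z)) := by
          intro z
          refine z.induction_on (by simp) (fun a b => ?_)
            (fun _ _ ha hb => by simp only [map_add, ha, hb])
          simp only [LinearMap.rTensor_tmul]
          rw [toCoinv_rColinear, natR]
        rw [toCoinv_rColinear, e1, h1, rl_comm]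
      counit := fun x => by
        obtain ⟨n, rfl⟩ := Submodule.mkQ_surjective _ x
        have h := (corestR_isRightCoaction f N.V.isCo).counit n
        rw [toCoinv_rColinear, ← rl_comm, h, LinearMap.rTensor_tmul] }

theorem actD_natural (f : C →ₗc[k] D) {M N : RMod (selfAlg f)} (g : M ⟶ N)
    (z : Cotensor (corestR f M.V.ρ) (lamf f)) :
    g.hom.lin (actD f M z) = actD f N
      (cotMap g.hom.lin LinearMap.id (g.hom.colin.corestR f) (LColinear.id _) z) := by
  rw [actD, actD, LinearMap.comp_apply, LinearMap.comp_apply, selfAct_natural]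
  apply congrArg (selfAct f N)
  apply incl_injective
  apply lTensor_inj _ (incl_injective (rhof f) (lamf f))
  rw [expand_spec, coe_cotMap, coe_cotMap]
  have e1 : ∀ t, (incl (rhof f) (lamf f)).lTensor N.V.carrier
      (TensorProduct.map g.hom.lin LinearMap.id t) =
      g.hom.lin.rTensor _ ((incl (rhof f) (lamf f)).lTensor M.V.carrier t) := by
    intro t
    refine t.induction_on (by simp) (fun a b => ?_)
      (fun _ _ ha hb => by simp only [map_add, ha, hb])
    simp
  rw [e1, expand_spec]
  generalize incl (corestR f M.V.ρ) (lamf f) z = t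
  refine t.induction_on (by simp) (fun a b => ?_)
    (fun _ _ ha hb => by simp only [map_add, ha, hb])
  have := g.hom.colin a
  simp only [LinearMap.rTensor_tmul, TensorProduct.map_tmul, this, natR, LinearMap.id_apply]

theorem epsD_natural (f : C →ₗc[k] D) {M N : RMod (selfAlg f)} (g : M ⟶ N)
    (z : Cotensor (corestR f M.V.ρ) (lamf f)) :
    g.hom.lin (epsD f M z) = epsD f N
      (cotMap g.hom.lin LinearMap.id (g.hom.colin.corestR f) (LColinear.id _) z) := by
  change g.hom.lin (rEps _ (incl _ _ z)) = rEps _ (incl _ _ _)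
  rw [coe_cotMap]
  generalize incl (corestR f M.V.ρ) (lamf f) z = t
  refine t.induction_on (by simp) (fun a b => ?_)
    (fun _ _ ha hb => by simp only [map_add, ha, hb])
  simp

/-- The map induced on coinvariants. -/
def coinvMap (f : C →ₗc[k] D) {M N : RMod (selfAlg f)} (g : M ⟶ N) :
    CoinvSpace f M →ₗ[k] CoinvSpace f N :=
  (LinearMap.range (actD f M - epsD f M)).liftQ (toCoinv f N ∘ₗ g.hom.lin) (by
    rintro _ ⟨z, rfl⟩
    rw [LinearMap.mem_ker, LinearMap.sub_apply, map_sub, sub_eq_zero, LinearMap.comp_apply,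
      LinearMap.comp_apply, actD_natural, epsD_natural, toCoinv_eq])

theorem coinvMap_toCoinv (f : C →ₗc[k] D) {M N : RMod (selfAlg f)} (g : M ⟶ N)
    (n : M.V.carrier) : coinvMap f g (toCoinv f M n) = toCoinv f N (g.hom.lin n) := rfl

theorem coinvMap_rColinear (f : C →ₗc[k] D) {M N : RMod (selfAlg f)} (g : M ⟶ N) :
    RColinear (coinvCoact f M) (coinvCoact f N) (coinvMap f g) := by
  intro x
  obtain ⟨n, rfl⟩ := Submodule.mkQ_surjective _ x
  have e : coinvMap f g ∘ₗ toCoinv f M = toCoinv f N ∘ₗ g.hom.lin := rfl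
  rw [coinvMap_toCoinv, toCoinv_rColinear, toCoinv_rColinear, g.hom.colin.corestR f,
    ← LinearMap.rTensor_comp_apply, ← LinearMap.rTensor_comp_apply, e]

/-- The functor of coinvariants `M_{C □_D C} → M^D`. -/
def coinvFunctor (f : C →ₗc[k] D) : RMod (selfAlg f) ⥤ RComod k D where
  obj N := coinvComod f N
  map g := ⟨coinvMap f g, coinvMap_rColinear f g⟩
  map_id N := by
    apply RComod.hom_ext
    apply LinearMap.ext
    intro x
    obtain ⟨n, rfl⟩ := Submodule.mkQ_surjective _ x
    rfl
  map_comp g h := by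
    apply RComod.hom_ext
    apply LinearMap.ext
    intro x
    obtain ⟨n, rfl⟩ := Submodule.mkQ_surjective _ x
    rfl

/-- The unit `N → N_{C □_D C} □_D C`, `n ↦ [n₀] ⊗ n₁`. -/
def adjUnitLin (f : C →ₗc[k] D) (N : RMod (selfAlg f)) :
    N.V.carrier →ₗ[k] Cotensor (coinvCoact f N) (lamf f) :=
  cotMap (toCoinv f N) LinearMap.id (toCoinv_rColinear f N) (LColinear.id _) ∘ₗ
    unitMap f N.V.ρ N.V.isCo

theorem adjUnitLin_spec (f : C →ₗc[k] D) (N : RMod (selfAlg f)) (n : N.V.carrier) :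
    incl _ _ (adjUnitLin f N n) = (toCoinv f N).rTensor C (N.V.ρ n) := rfl

theorem adjUnitLin_rColinear (f : C →ₗc[k] D) (N : RMod (selfAlg f)) :
    RColinear N.V.ρ (cotC f (coinvCoact f N)) (adjUnitLin f N) := by
  intro n
  apply rTensor_inj _ (incl_injective _ _)
  rw [cotR_spec, adjUnitLin_spec, ← LinearMap.rTensor_comp_apply]
  change _ = ((toCoinv f N).rTensor C ∘ₗ N.V.ρ).rTensor C _
  rw [LinearMap.rTensor_comp_apply, ← rl_comm, ← N.V.isCo.coassoc]
  generalize N.V.ρ.rTensor C (N.V.ρ n) = t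
  refine t.induction_on (by simp) (fun a b => ?_)
    (fun _ _ ha hb => by simp only [map_add, ha, hb])
  rw [natR, LinearEquiv.symm_apply_apply, LinearMap.rTensor_tmul]

theorem adjUnitLin_equivariant (f : C →ₗc[k] D) (N : RMod (selfAlg f))
    (y : Cotensor N.V.ρ (selfL f)) :
    adjUnitLin f N (selfAct f N y) = cotAct f (coinvCoact f N)
      (cotMap (adjUnitLin f N) LinearMap.id (adjUnitLin_rColinear f N) (LColinear.id _) y) := by
  apply incl_injective
  let s : N.V.carrier ⊗[k] Cotensor (rhof f) (lamf f) →ₗ[k] N.V.carrier :=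
    rEps (C := C) N.V.carrier ∘ₗ (lEps C ∘ₗ incl (rhof f) (lamf f)).lTensor N.V.carrier
  have e1 : ∀ y : Cotensor N.V.ρ (selfL f),
      toCoinv f N (selfAct f N y) = toCoinv f N (s (incl _ _ y)) := by
    intro y
    have h := toCoinv_eq f N (contract f N.V.ρ y)
    rw [show actD f N (contract f N.V.ρ y) =
      selfAct f N (expand f N.V.ρ N.V.isCo (contract f N.V.ρ y)) from rfl, expand_contract] at h
    exact h
  have h1 : N.V.ρ (selfAct f N y) = (selfAct f N).rTensor C
      (cotR N.V.ρ (selfL f) (cotC f (rhof f)) (self_commutes f) y) := selfAct_rColinear f N y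
  have e2 : toCoinv f N ∘ₗ selfAct f N = (toCoinv f N ∘ₗ s) ∘ₗ incl N.V.ρ (selfL f) :=
    LinearMap.ext e1
  have e3 : (toCoinv f N).rTensor C ((selfAct f N).rTensor C
      (cotR N.V.ρ (selfL f) (cotC f (rhof f)) (self_commutes f) y)) =
      (toCoinv f N ∘ₗ s).rTensor C ((incl N.V.ρ (selfL f)).rTensor C
        (cotR N.V.ρ (selfL f) (cotC f (rhof f)) (self_commutes f) y)) := by
    rw [← LinearMap.rTensor_comp_apply, ← LinearMap.rTensor_comp_apply]
    exact congrArg (fun g => LinearMap.rTensor C g _) e2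
  rw [adjUnitLin_spec, h1, e3, cotR_spec, cotAct_spec, coe_cotMap]
  generalize incl N.V.ρ (selfL f) y = z
  refine z.induction_on (by simp) (fun a b => ?_)
    (fun _ _ ha hb => by simp only [map_add, ha, hb])
  have e4 : rEps (k := k) (C := C) _ (incl _ _ (adjUnitLin f N a)) = toCoinv f N a := by
    have h0 := congrArg (toCoinv f N) (N.V.isCo.rEps a)
    rw [adjUnitLin_spec, ← h0]
    generalize N.V.ρ a = t
    refine t.induction_on (by simp) (fun a b => ?_)
      (fun _ _ ha hb => by simp only [map_add, ha, hb])
    simp only [LinearMap.rTensor_tmul, rEps_tmul, map_smul]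
  have e5 : lEps (k := k) (C := C) C ((lEps C ∘ₗ incl (rhof f) (lamf f)).rTensor C
      (cotC f (rhof f) b)) = lEps C (incl (rhof f) (lamf f) b) := by
    rw [← comul_lEps]
    simp [lEps]
  simp only [TensorProduct.map_tmul, LinearMap.comp_apply, LinearMap.id_apply,
    LinearMap.lTensor_tmul]
  rw [e4, ← e5]
  generalize cotC f (rhof f) b = t
  refine t.induction_on (by simp) (fun a b => ?_)
    (fun _ _ ha hb => by simp only [map_add, tmul_add, ha, hb])
  simp [s, smul_tmul]

theorem rEps_cotAct_expand (f : C →ₗc[k] D) {W : Type v} [AddCommGroup W] [Module k W]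
    (ρ : W →ₗ[k] W ⊗[k] D) (hρ : IsRightCoaction (cotC f ρ))
    (z : Cotensor (corestR f (cotC f ρ)) (lamf f)) :
    rEps W (incl ρ (lamf f) (cotAct f ρ (expand f (cotC f ρ) hρ z))) =
      rEps W (incl ρ (lamf f) (rEps _ (incl _ _ z))) := by
  have h := expand_spec f (cotC f ρ) hρ z
  have e1 : ∀ t, TensorProduct.map (rEps W ∘ₗ incl ρ (lamf f))
      (lEps (k := k) (C := C) C ∘ₗ incl (rhof f) (lamf f)) t =
      TensorProduct.map (rEps W ∘ₗ incl ρ (lamf f)) (lEps (k := k) (C := C) C)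
        ((incl (rhof f) (lamf f)).lTensor _ t) := by
    intro t
    refine t.induction_on (by simp) (fun a b => ?_)
      (fun _ _ ha hb => by simp only [map_add, ha, hb])
    simp
  rw [cotAct_spec, e1, h]
  generalize incl (corestR f (cotC f ρ)) (lamf f) z = t
  refine t.induction_on (by simp) (fun a b => ?_)
    (fun _ _ ha hb => by simp only [map_add, ha, hb])
  have h0 := congrArg (fun t => Coalgebra.counit (R := k) b •
    rEps W (incl ρ (lamf f) t)) (hρ.rEps a)
  simp only [LinearMap.rTensor_tmul, rEps_tmul, map_smul] at h0 ⊢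
  rw [← h0]
  generalize cotC f ρ a = t
  refine t.induction_on (by simp) (fun a c => ?_)
    (fun _ _ ha hb => by simp only [map_add, add_tmul, smul_add, ha, hb])
  simp [smul_smul, mul_comm]

/-- The counit `(W □_D C)_{C □_D C} → W`, `[w ⊗ c] ↦ ε(c) w`. -/
def adjCounitLin (f : C →ₗc[k] D) (W : RComod k D) :
    CoinvSpace f (cotMod f W) →ₗ[k] W.carrier :=
  (LinearMap.range (actD f (cotMod f W) - epsD f (cotMod f W))).liftQ
    (rEps W.carrier ∘ₗ incl W.ρ (lamf f)) (by
      rintro _ ⟨z, rfl⟩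
      rw [LinearMap.mem_ker, LinearMap.sub_apply, map_sub, sub_eq_zero]
      exact rEps_cotAct_expand f W.ρ (cotComod f W).isCo z)

theorem adjCounitLin_spec (f : C →ₗc[k] D) (W : RComod k D) (y : Cotensor W.ρ (lamf f)) :
    adjCounitLin f W (toCoinv f (cotMod f W) y) = rEps W.carrier (incl W.ρ (lamf f) y) := rfl

theorem adjCounitLin_rColinear (f : C →ₗc[k] D) (W : RComod k D) :
    RColinear (coinvCoact f (cotMod f W)) W.ρ (adjCounitLin f W) := by
  intro x
  obtain ⟨y, rfl⟩ := Submodule.mkQ_surjective _ x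
  have h : ∀ y : Cotensor W.ρ (lamf f), W.ρ (rEps W.carrier (incl W.ρ (lamf f) y)) =
      (rEps W.carrier ∘ₗ incl W.ρ (lamf f)).rTensor D
        ((f : C →ₗ[k] D).lTensor _ (cotC f W.ρ y)) := by
    intro y
    rw [coact_rEps, rl_comm, LinearMap.rTensor_comp_apply, cotR_spec, rEps_comul]
  exact (h y).trans (LinearMap.rTensor_comp_apply D (adjCounitLin f W)
    (toCoinv f (cotMod f W)) _)

/-- The adjunction between coinvariants and `- □_D C`. -/
def descentAdj (f : C →ₗc[k] D) : coinvFunctor f ⊣ cotFunctor f :=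
  Adjunction.mkOfUnitCounit
    { unit :=
        { app := fun N =>
            { hom := ⟨adjUnitLin f N, adjUnitLin_rColinear f N⟩
              equivariant := adjUnitLin_equivariant f N }
          naturality := fun M N g => by
            apply RMod.hom_ext
            apply LinearMap.ext
            intro x
            apply incl_injective (coinvCoact f N) (lamf f)
            change (toCoinv f N).rTensor C (N.V.ρ (g.hom.lin x)) =
              TensorProduct.map (coinvMap f g) LinearMap.id
                ((toCoinv f M).rTensor C (M.V.ρ x))
            rw [g.hom.colin]
            generalize M.V.ρ x = t
            refine t.induction_on (by simp) (fun a b => ?_)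
              (fun _ _ ha hb => by simp only [map_add, ha, hb])
            rfl }
      counit :=
        { app := fun W => ⟨adjCounitLin f W, adjCounitLin_rColinear f W⟩
          naturality := fun W W' g => by
            apply RComod.hom_ext
            apply LinearMap.ext
            intro x
            obtain ⟨y, rfl⟩ := Submodule.mkQ_surjective _ x
            change rEps W'.carrier (TensorProduct.map g.lin LinearMap.id (incl W.ρ (lamf f) y)) =
              g.lin (rEps W.carrier (incl W.ρ (lamf f) y))
            generalize incl W.ρ (lamf f) y = t
            refine t.induction_on (by simp) (fun a b => ?_)
              (fun _ _ ha hb => by simp only [map_add, ha, hb])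
            simp }
      left_triangle := by
        ext N : 2
        apply RComod.hom_ext
        apply LinearMap.ext
        intro x
        obtain ⟨n, rfl⟩ := Submodule.mkQ_surjective _ x
        change rEps _ ((toCoinv f N).rTensor C (N.V.ρ n)) = toCoinv f N n
        have h0 := congrArg (toCoinv f N) (N.V.isCo.rEps n)
        rw [← h0]
        generalize N.V.ρ n = t
        refine t.induction_on (by simp) (fun a b => ?_)
          (fun _ _ ha hb => by simp only [map_add, ha, hb])
        simp only [LinearMap.rTensor_tmul, rEps_tmul, map_smul]
      right_triangle := by
        ext W : 2
        apply RMod.hom_ext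
        apply LinearMap.ext
        intro y
        apply incl_injective W.ρ (lamf f)
        change TensorProduct.map (adjCounitLin f W) LinearMap.id
          ((toCoinv f (cotMod f W)).rTensor C (cotC f W.ρ y)) = incl W.ρ (lamf f) y
        have h : ∀ y : Cotensor W.ρ (lamf f),
            (rEps W.carrier ∘ₗ incl W.ρ (lamf f)).rTensor C (cotC f W.ρ y) =
              incl W.ρ (lamf f) y := by
          intro y
          rw [LinearMap.rTensor_comp_apply, cotR_spec, rEps_comul]
        exact (LinearMap.rTensor_comp_apply C (adjCounitLin f W)
          (toCoinv f (cotMod f W)) _).symm.trans (h y) }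

/-- The functor `- □_C M : M^C → Vec` for a left `C`-comodule `M`. -/
def cotVec (M : LComod k C) : RComod k C ⥤ ModuleCat.{v} k where
  obj V := ModuleCat.of k (Cotensor V.ρ M.l)
  map g := ModuleCat.ofHom (cotMap g.lin LinearMap.id g.colin (LColinear.id _))
  map_id V := by
    apply ModuleCat.hom_ext
    apply LinearMap.ext
    intro x
    apply incl_injective V.ρ M.l
    change TensorProduct.map LinearMap.id LinearMap.id (incl V.ρ M.l x) = incl V.ρ M.l x
    rw [TensorProduct.map_id, LinearMap.id_apply]
  map_comp {U V W} g h := by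
    apply ModuleCat.hom_ext
    apply LinearMap.ext
    intro x
    apply incl_injective W.ρ M.l
    change TensorProduct.map (h.lin ∘ₗ g.lin) LinearMap.id (incl U.ρ M.l x) =
      TensorProduct.map h.lin LinearMap.id (TensorProduct.map g.lin LinearMap.id
        (incl U.ρ M.l x))
    simp only [TensorProduct.map_map, LinearMap.id_comp]

/-- A left `C`-comodule `M` is coflat if `- □_C M : M^C → Vec` is exact, that is, takes short
exact sequences to short exact sequences. Kernels and cokernels of comodules over a field are
those of the underlying vector spaces. -/
def LComod.IsCoflat (M : LComod k C) : Prop :=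
  ∀ (X Y Z : RComod k C) (i : X ⟶ Y) (p : Y ⟶ Z), Function.Injective i.lin →
    Function.Exact i.lin p.lin → Function.Surjective p.lin →
      Function.Injective ((cotVec M).map i).hom ∧
      Function.Exact ((cotVec M).map i).hom ((cotVec M).map p).hom ∧
      Function.Surjective ((cotVec M).map p).hom

/-- A left `C`-comodule `M` is faithfully coflat if `- □_C M` is exact and faithful. -/
def LComod.IsFaithfullyCoflat (M : LComod k C) : Prop :=
  M.IsCoflat ∧ (cotVec M).Faithful

/-- `C` as a left `D`-comodule along `f`. -/
def leftComodOf (f : C →ₗc[k] D) : LComod k D where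
  carrier := C
  l := lamf f
  isCo := corestL_isLeftCoaction f comul_isLeftCoaction

/-- A coalgebra morphism `f : C → D` is left faithfully coflat if `C` is so as a left
`D`-comodule. -/
def LeftFaithfullyCoflat (f : C →ₗc[k] D) : Prop := (leftComodOf f).IsFaithfullyCoflat

/-- `f : C → D` has a right inverse in `D`-bicomodules. -/
def SplitsInBicomodules (f : C →ₗc[k] D) : Prop :=
  ∃ s : D →ₗ[k] C, LColinear Coalgebra.comul (lamf f) s ∧ RColinear Coalgebra.comul (rhof f) s ∧
    (f : C →ₗ[k] D) ∘ₗ s = LinearMap.id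

end Cats

end

end CoalgDescent

/-!
Corestriction along `f` is left adjoint to `- □_D C : M^D ⥤ M^C`, and through the isomorphism
`N □_D C ≅ N □_C (C □_D C)` the `C □_D C`-modules become the algebras for the monad of this
adjunction, in such a way that `- □_D C : M^D ⥤ M_{C □_D C}` becomes Beck's comparison functor. Both
conditions on `f` make the adjunction monadic. If `f` is left faithfully coflat, `- □_D C` preserves
all coequalizers, and it reflects isomorphisms because it is faithful and `M^D` is balanced. If
`s : D → C` is a right inverse of `f` in `D`-bicomodules, then `id ⊗ s : W ≅ W □_D D → W □_D C` is a
natural section of the counit; the right adjoint of an adjunction with such a section is separable,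
so it reflects isomorphisms, and pairs which it turns into split pairs have split, hence absolute,
coequalizers.
-/

namespace CoalgDescent

open Limits

noncomputable section

section SeparableRightAdjoint

universe w₁ u₁ u₂

variable {𝒞 : Type u₁} [Category.{w₁} 𝒞] {𝒟 : Type u₂} [Category.{w₁} 𝒟] {F : 𝒞 ⥤ 𝒟}
  {G : 𝒟 ⥤ 𝒞} (adj : F ⊣ G) (σ : 𝟭 𝒟 ⟶ G ⋙ F)

/-- The morphism `X ⟶ Y` obtained from a morphism `G X ⟶ G Y` by means of a transformation `σ` from
the identity to `G ⋙ F`. If `σ` is a section of the counit, it exhibits the right adjoint `G` as a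
separable functor. -/
def separate {X Y : 𝒟} (a : G.obj X ⟶ G.obj Y) : X ⟶ Y :=
  σ.app X ≫ F.map a ≫ adj.counit.app Y

theorem comp_separate {X Y Z : 𝒟} (g : X ⟶ Y) (a : G.obj Y ⟶ G.obj Z) :
    g ≫ separate adj σ a = separate adj σ (G.map g ≫ a) := by
  have h : g ≫ σ.app Y = σ.app X ≫ F.map (G.map g) := σ.naturality g
  simp only [separate, reassoc_of% h, F.map_comp, Category.assoc]

theorem separate_comp {X Y Z : 𝒟} (a : G.obj X ⟶ G.obj Y) (g : Y ⟶ Z) :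
    separate adj σ a ≫ g = separate adj σ (a ≫ G.map g) := by
  simp only [separate, F.map_comp, Category.assoc, adj.counit_naturality]

variable {σ} (hσ : σ ≫ adj.counit = 𝟙 (𝟭 𝒟))

include hσ

theorem separate_map {X Y : 𝒟} (g : X ⟶ Y) : separate adj σ (G.map g) = g := by
  have h : σ.app X ≫ adj.counit.app X = 𝟙 X := NatTrans.congr_app hσ X
  rw [separate, adj.counit_naturality, reassoc_of% h]

theorem separate_id (X : 𝒟) : separate adj σ (𝟙 (G.obj X)) = 𝟙 X := by
  rw [← G.map_id, separate_map adj hσ]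

theorem reflectsIsomorphisms_of_counit_section : G.ReflectsIsomorphisms where
  reflects g _ := by
    refine ⟨separate adj σ (inv (G.map g)), ?_, ?_⟩
    · rw [comp_separate, IsIso.hom_inv_id, separate_id adj hσ]
    · rw [separate_comp, IsIso.inv_hom_id, separate_id adj hσ]

theorem hasSplitCoequalizer_of_counit_section {X Y : 𝒟} (g h : X ⟶ Y) [HasCoequalizer g h]
    [G.IsSplitPair g h] : HasSplitCoequalizer g h := by
  obtain ⟨Z, q, ⟨split⟩⟩ := HasSplitCoequalizer.splittable (f := G.map g) (g := G.map h)
  let t : Y ⟶ X := separate adj σ split.leftSection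
  have t_bottom : t ≫ h = 𝟙 Y := by
    rw [separate_comp, split.leftSection_bottom, separate_id adj hσ]
  have t_top : g ≫ t ≫ g = h ≫ t ≫ g := by
    rw [separate_comp, comp_separate, comp_separate, split.leftSection_top, split.condition_assoc]
  exact ⟨coequalizer g h, coequalizer.π g h,
    ⟨{
      rightSection := coequalizer.desc (t ≫ g) t_top
      leftSection := t
      condition := coequalizer.condition g h
      rightSection_π := coequalizer.hom_ext (by
        rw [coequalizer.π_desc_assoc, Category.assoc, coequalizer.condition,
          reassoc_of% t_bottom, Category.comp_id])
      leftSection_bottom := t_bottom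
      leftSection_top := (coequalizer.π_desc _ _).symm }⟩⟩

theorem comparison_isEquivalence_of_counit_section [Monad.HasCoequalizerOfIsSplitPair G] :
    (Monad.comparison adj).IsEquivalence :=
  have := reflectsIsomorphisms_of_counit_section adj hσ
  have : Monad.PreservesColimitOfIsSplitPair G := ⟨fun g h _ =>
    have := Monad.HasCoequalizerOfIsSplitPair.out G g h
    have := hasSplitCoequalizer_of_counit_section adj hσ g h
    inferInstance⟩
  (Monad.monadicOfHasPreservesGSplitCoequalizersOfReflectsIsomorphisms adj).eqv

end SeparableRightAdjoint

variable {k : Type u} [Field k] {C D : Type v} [AddCommGroup C] [Module k C] [Coalgebra k C]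
  [AddCommGroup D] [Module k D]

section Coactions

variable {V V' V'' : Type v} [AddCommGroup V] [Module k V] [AddCommGroup V'] [Module k V']
  [AddCommGroup V''] [Module k V''] {ρ : V →ₗ[k] V ⊗[k] D} {ρ' : V' →ₗ[k] V' ⊗[k] D}
  {ρ'' : V'' →ₗ[k] V'' ⊗[k] D} {g h : V →ₗ[k] V'}

theorem assoc_rTensor_rTensor (hg : RColinear ρ ρ' g) {Y : Type*} [AddCommGroup Y] [Module k Y]
    (z : V ⊗[k] Y) :
    TensorProduct.assoc k V' D Y (ρ'.rTensor Y (g.rTensor Y z)) =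
      g.rTensor (D ⊗[k] Y) (TensorProduct.assoc k V D Y (ρ.rTensor Y z)) := by
  have hρ : ρ' ∘ₗ g = g.rTensor D ∘ₗ ρ := LinearMap.ext hg
  rw [← LinearMap.rTensor_comp_apply, hρ, LinearMap.rTensor_comp_apply, LinearMap.rTensor_tensor]
  simp

theorem RColinear.comp {a : V' →ₗ[k] V''} (ha : RColinear ρ' ρ'' a) (hg : RColinear ρ ρ' g) :
    RColinear ρ ρ'' (a ∘ₗ g) := fun x => by
  rw [LinearMap.comp_apply, ha, hg, LinearMap.rTensor_comp_apply]

theorem cotMap_comp {W : Type v} [AddCommGroup W] [Module k W] {l : W →ₗ[k] D ⊗[k] W}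
    {a : V' →ₗ[k] V''} (ha : RColinear ρ' ρ'' a) (hg : RColinear ρ ρ' g) (x : Cotensor ρ l) :
    cotMap (a ∘ₗ g) LinearMap.id (ha.comp hg) (LColinear.id l) x =
      cotMap a LinearMap.id ha (LColinear.id l) (cotMap g LinearMap.id hg (LColinear.id l) x) :=
  incl_injective ρ'' l (LinearMap.rTensor_comp_apply W a g _)

theorem RColinear.sub (hg : RColinear ρ ρ' g) (hh : RColinear ρ ρ' h) :
    RColinear ρ ρ' (g - h) := fun x => by
  rw [LinearMap.rTensor_sub, LinearMap.sub_apply, LinearMap.sub_apply, map_sub, hg, hh]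

/-- The coaction on the kernel of a colinear map. The kernel is encoded as an equalizer of linear
maps, as `liftR` expects. -/
def kerCoact (hg : RColinear ρ ρ' g) :
    LinearMap.eqLocus g 0 →ₗ[k] LinearMap.eqLocus g (0 : V →ₗ[k] V') ⊗[k] D :=
  liftR g 0 (ρ ∘ₗ (LinearMap.eqLocus g 0).subtype) (fun x => by
    have hx : g x = 0 := x.2
    rw [LinearMap.rTensor_zero, LinearMap.comp_apply, ← hg, Submodule.subtype_apply, hx, map_zero,
      LinearMap.zero_apply])

theorem subtype_rColinear (hg : RColinear ρ ρ' g) :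
    RColinear (kerCoact hg) ρ (LinearMap.eqLocus g 0).subtype := fun x =>
  (liftR_spec g 0 (ρ ∘ₗ (LinearMap.eqLocus g 0).subtype) _ x).symm

variable [Coalgebra k D]

theorem IsRightCoaction.of_injective (hρ' : IsRightCoaction ρ') (hg : RColinear ρ ρ' g)
    (hi : Function.Injective g) : IsRightCoaction ρ where
  coassoc x := by
    apply rTensor_inj _ hi
    rw [← assoc_rTensor_rTensor hg, ← hg, hρ'.coassoc, hg, rl_comm]
  counit x := by
    apply rTensor_inj _ hi
    rw [rl_comm, ← hg, hρ'.counit, LinearMap.rTensor_tmul]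

theorem IsRightCoaction.of_surjective (hρ : IsRightCoaction ρ) (hg : RColinear ρ ρ' g)
    (hs : Function.Surjective g) : IsRightCoaction ρ' where
  coassoc x := by
    obtain ⟨x, rfl⟩ := hs x
    rw [hg, assoc_rTensor_rTensor hg, hρ.coassoc, rl_comm]
  counit x := by
    obtain ⟨x, rfl⟩ := hs x
    rw [hg, ← rl_comm, hρ.counit, LinearMap.rTensor_tmul]

end Coactions

variable [Coalgebra k D]

namespace RComod

variable {X Y Z : RComod k D}

instance : Zero (X ⟶ Y) := ⟨⟨0, fun x => by simp⟩⟩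

instance : Sub (X ⟶ Y) := ⟨fun g h => ⟨g.lin - h.lin, g.colin.sub h.colin⟩⟩

theorem sub_lin (g h : X ⟶ Y) : (g - h).lin = g.lin - h.lin := rfl

theorem isIso_of_bijective (g : X ⟶ Y) (hg : Function.Bijective g.lin) : IsIso g := by
  let e := LinearEquiv.ofBijective g.lin hg
  have right_inv : g.lin ∘ₗ e.symm.toLinearMap = LinearMap.id := LinearMap.ext e.apply_symm_apply
  have left_inv : e.symm.toLinearMap ∘ₗ g.lin = LinearMap.id := LinearMap.ext e.symm_apply_apply
  have colin : RColinear Y.ρ X.ρ e.symm.toLinearMap := fun x => by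
    apply rTensor_inj _ hg.1
    rw [← g.colin, ← LinearMap.rTensor_comp_apply, right_inv, LinearMap.rTensor_id,
      LinearMap.id_apply]
    exact congrArg Y.ρ (e.apply_symm_apply x)
  exact ⟨⟨_, colin⟩, hom_ext left_inv, hom_ext right_inv⟩

/-- The kernel of a morphism of right comodules, as a subcomodule. -/
def ker (g : X ⟶ Y) : RComod k D where
  carrier := LinearMap.eqLocus g.lin 0
  ρ := kerCoact g.colin
  isCo := X.isCo.of_injective (subtype_rColinear g.colin) (Submodule.injective_subtype _)

/-- The inclusion of the kernel of a morphism of right comodules. -/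
def kerι (g : X ⟶ Y) : ker g ⟶ X :=
  ⟨(LinearMap.eqLocus g.lin 0).subtype, subtype_rColinear g.colin⟩

theorem kerι_injective (g : X ⟶ Y) : Function.Injective (kerι g).lin :=
  Submodule.injective_subtype _

theorem kerι_exact (g : X ⟶ Y) : Function.Exact (kerι g).lin g.lin := fun x =>
  ⟨fun h => ⟨⟨x, h⟩, rfl⟩, by rintro ⟨y, rfl⟩; exact y.2⟩

/-- The factorization through the kernel of a morphism of right comodules. -/
def kerLift (h : X ⟶ Y) (g : Y ⟶ Z) (w : ∀ x, g.lin (h.lin x) = 0) : X ⟶ ker g where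
  lin := h.lin.codRestrict (LinearMap.eqLocus g.lin 0) w
  colin x := by
    apply rTensor_inj _ (kerι_injective g)
    refine ((kerι g).colin _).symm.trans ((h.colin x).trans ?_)
    exact LinearMap.rTensor_comp_apply D (kerι g).lin (h.lin.codRestrict _ w) (X.ρ x)

/-- The coequalizer of two morphisms of right comodules, as a quotient of the target. -/
def coeq (g h : X ⟶ Y) : RComod k D :=
  let R := LinearMap.range (g - h).lin
  have hR : R ≤ LinearMap.ker (R.mkQ.rTensor D ∘ₗ Y.ρ) := by
    rintro _ ⟨x, rfl⟩
    rw [LinearMap.mem_ker, LinearMap.comp_apply, (g - h).colin, ← LinearMap.rTensor_comp_apply,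
      LinearMap.range_mkQ_comp]
    simp
  { carrier := Y.carrier ⧸ R
    ρ := R.liftQ (R.mkQ.rTensor D ∘ₗ Y.ρ) hR
    isCo := Y.isCo.of_surjective (g := R.mkQ) (fun _ => rfl) R.mkQ_surjective }

/-- The projection onto the coequalizer of two morphisms of right comodules. -/
def coeqπ (g h : X ⟶ Y) : Y ⟶ coeq g h := ⟨(LinearMap.range (g - h).lin).mkQ, fun _ => rfl⟩

theorem coeqπ_surjective (g h : X ⟶ Y) : Function.Surjective (coeqπ g h).lin :=
  Submodule.mkQ_surjective _

theorem coeqπ_exact (g h : X ⟶ Y) : Function.Exact (g - h).lin (coeqπ g h).lin :=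
  LinearMap.exact_iff.2 (Submodule.ker_mkQ _)

theorem comp_eq_comp_of_exact {g h : X ⟶ Y} {p : Y ⟶ Z} (he : Function.Exact (g - h).lin p.lin) :
    g ≫ p = h ≫ p := by
  refine hom_ext (sub_eq_zero.1 ?_)
  rw [comp_lin, comp_lin, ← LinearMap.comp_sub]
  exact he.linearMap_comp_eq_zero

section Desc

variable {W : RComod k D} {p : Y ⟶ Z} (hp : Function.Surjective p.lin) {q : Y ⟶ W}
  (hq : LinearMap.ker p.lin ≤ LinearMap.ker q.lin)

/-- The factorization of a morphism of right comodules through a surjective one. -/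
def desc : Z ⟶ W :=
  let d := (LinearMap.ker p.lin).liftQ q.lin hq ∘ₗ
    (p.lin.quotKerEquivOfSurjective hp).symm.toLinearMap
  have d_comp (y : Y.carrier) : d (p.lin y) = q.lin y :=
    congrArg ((LinearMap.ker p.lin).liftQ q.lin hq)
      ((p.lin.quotKerEquivOfSurjective hp).symm_apply_apply ((LinearMap.ker p.lin).mkQ y))
  { lin := d
    colin := fun z => by
      obtain ⟨y, rfl⟩ := hp z
      have hd : d ∘ₗ p.lin = q.lin := LinearMap.ext d_comp
      rw [d_comp, q.colin, p.colin, ← LinearMap.rTensor_comp_apply, hd] }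

theorem comp_desc : p ≫ desc hp hq = q :=
  hom_ext (LinearMap.ext fun y => congrArg ((LinearMap.ker p.lin).liftQ q.lin hq)
    ((p.lin.quotKerEquivOfSurjective hp).symm_apply_apply ((LinearMap.ker p.lin).mkQ y)))

end Desc

theorem epi_of_surjective {p : Y ⟶ Z} (hp : Function.Surjective p.lin) : Epi p where
  left_cancellation u v h := hom_ext (LinearMap.ext fun z => by
    obtain ⟨y, rfl⟩ := hp z
    exact LinearMap.congr_fun (congrArg Hom.lin h) y)

/-- Right exact sequences of comodules present their last term as a coequalizer. -/
def isColimitCofork {g h : X ⟶ Y} {p : Y ⟶ Z} (he : Function.Exact (g - h).lin p.lin)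
    (hp : Function.Surjective p.lin) : IsColimit (Cofork.ofπ p (comp_eq_comp_of_exact he)) := by
  have hq (s : Cofork g h) : LinearMap.ker p.lin ≤ LinearMap.ker s.π.lin := by
    rw [he.linearMap_ker_eq]
    rintro _ ⟨x, rfl⟩
    rw [LinearMap.mem_ker, sub_lin, LinearMap.sub_apply, map_sub, sub_eq_zero]
    exact LinearMap.congr_fun (congrArg Hom.lin s.condition) x
  have := epi_of_surjective hp
  exact Cofork.IsColimit.mk _ (fun s => desc hp (hq s)) (fun s => comp_desc hp (hq s))
    (fun s m hm => (cancel_epi p).1 (hm.trans (comp_desc hp (hq s)).symm))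

instance : HasCoequalizers (RComod k D) :=
  have (X Y : RComod k D) (g h : X ⟶ Y) : HasColimit (parallelPair g h) :=
    ⟨⟨_, isColimitCofork (coeqπ_exact g h) (coeqπ_surjective g h)⟩⟩
  hasCoequalizers_of_hasColimit_parallelPair _

theorem injective_of_mono (g : X ⟶ Y) [Mono g] : Function.Injective g.lin := by
  have h : kerι g = 0 := by
    rw [← cancel_mono g]
    refine hom_ext ((kerι_exact g).linearMap_comp_eq_zero.trans (LinearMap.comp_zero _).symm)
  refine (injective_iff_map_eq_zero g.lin).2 fun x hx => ?_
  exact LinearMap.congr_fun (congrArg Hom.lin h) (⟨x, hx⟩ : LinearMap.eqLocus g.lin 0)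

theorem surjective_of_epi (g : X ⟶ Y) [Epi g] : Function.Surjective g.lin := by
  have h : coeqπ g 0 = 0 := by
    rw [← cancel_epi g, comp_eq_comp_of_exact (coeqπ_exact g 0)]
    rfl
  have hg : g.lin - 0 = g.lin := sub_zero g.lin
  rw [← LinearMap.range_eq_top, ← hg, ← Submodule.ker_mkQ (LinearMap.range _)]
  exact LinearMap.ker_eq_top.2 (congrArg Hom.lin h)

instance : Balanced (RComod k D) where
  isIso_of_mono_of_epi g _ _ := isIso_of_bijective g ⟨injective_of_mono g, surjective_of_epi g⟩

end RComod

theorem LComod.IsCoflat.surjective {M : LComod k D} (hM : M.IsCoflat) {X Y : RComod k D}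
    (p : X ⟶ Y) (hp : Function.Surjective p.lin) : Function.Surjective ((cotVec M).map p).hom :=
  (hM _ _ _ (RComod.kerι p) p (RComod.kerι_injective p) (RComod.kerι_exact p) hp).2.2

theorem LComod.IsCoflat.exact {M : LComod k D} (hM : M.IsCoflat) {X Y Z : RComod k D}
    (g : X ⟶ Y) (p : Y ⟶ Z) (h : Function.Exact g.lin p.lin) (hp : Function.Surjective p.lin) :
    Function.Exact ((cotVec M).map g).hom ((cotVec M).map p).hom := by
  let g' := RComod.kerLift g p h.apply_apply_eq_zero
  have hg' : Function.Surjective g'.lin := by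
    rintro ⟨y, hy⟩
    obtain ⟨x, hx⟩ := (h y).1 hy
    exact ⟨x, Subtype.ext hx⟩
  have ker_exact : Function.Exact ((cotVec M).map (RComod.kerι p)).hom ((cotVec M).map p).hom :=
    (hM _ _ _ _ p (RComod.kerι_injective p) (RComod.kerι_exact p) hp).2.1
  rw [← Function.Surjective.comp_exact_iff_exact (hM.surjective g' hg')] at ker_exact
  have factor : g = g' ≫ RComod.kerι p := rfl
  rwa [factor, Functor.map_comp]

/-- The functor from modules over an algebra in bicomodules to comodules forgetting the action. -/
def RMod.forget (A : IntAlg k C) : RMod A ⥤ RComod k C where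
  obj N := N.V
  map g := g.hom

variable (f : C →ₗc[k] D)

/-- The functor `M^C ⥤ M^D` of corestriction along `f`. -/
def corestrict : RComod k C ⥤ RComod k D where
  obj V := ⟨V.carrier, corestR f V.ρ, corestR_isRightCoaction f V.isCo⟩
  map g := ⟨g.lin, g.colin.corestR f⟩

/-- The functor `- □_D C : M^D ⥤ M^C`, that is, `cotFunctor f` without its module structure. -/
abbrev cotensorFunctor : RComod k D ⥤ RComod k C :=
  cotFunctor f ⋙ RMod.forget (selfAlg f)

section Counit

variable {V W : Type v} [AddCommGroup V] [Module k V] [AddCommGroup W] [Module k W]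
  {ρ : V →ₗ[k] V ⊗[k] D} {ρ' : W →ₗ[k] W ⊗[k] D}

/-- The map `id ⊗ ε : W □_D C → W`. -/
abbrev cotEps (ρ : W →ₗ[k] W ⊗[k] D) : Cotensor ρ (lamf f) →ₗ[k] W :=
  rEps W ∘ₗ incl ρ (lamf f)

theorem rEps_rTensor (g : V →ₗ[k] W) (z : V ⊗[k] C) :
    rEps W (g.rTensor C z) = g (rEps V z) := by
  induction z with
  | zero => simp
  | add a b ha hb => simp only [map_add, ha, hb]
  | tmul a b => simp

theorem cotEps_rTensor_cotC (y : Cotensor ρ (lamf f)) :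
    (cotEps f ρ).rTensor C (cotC f ρ y) = incl ρ (lamf f) y := by
  rw [LinearMap.rTensor_comp_apply, cotR_spec, rEps_comul]

theorem cotEps_rColinear : RColinear (corestR f (cotC f ρ)) ρ (cotEps f ρ) := fun y => by
  rw [LinearMap.comp_apply, coact_rEps, ← cotEps_rTensor_cotC, corestR, LinearMap.comp_apply,
    rl_comm]

end Counit

/-- The adjunction between corestriction along `f` and `- □_D C`. -/
def corestAdj : corestrict f ⊣ cotensorFunctor f :=
  Adjunction.mkOfUnitCounit
    { unit :=
        { app := fun V => ⟨unitMap f V.ρ V.isCo, unitMap_rColinear f V.ρ V.isCo⟩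
          naturality := fun V V' g => RComod.hom_ext <| LinearMap.ext fun x =>
            incl_injective (corestR f V'.ρ) (lamf f) (g.colin x) }
      counit :=
        { app := fun W => ⟨cotEps f W.ρ, cotEps_rColinear f⟩
          naturality := fun W W' g => RComod.hom_ext <| LinearMap.ext fun y =>
            rEps_rTensor g.lin (incl W.ρ (lamf f) y) }
      left_triangle := by
        ext V : 2
        exact RComod.hom_ext (LinearMap.ext V.isCo.rEps)
      right_triangle := by
        ext W : 2
        exact RComod.hom_ext <| LinearMap.ext fun y =>
          incl_injective W.ρ (lamf f) (cotEps_rTensor_cotC f y) }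

variable {f}

theorem cotensorFunctor_map_sub {X Y : RComod k D} (g h : X ⟶ Y) :
    (cotensorFunctor f).map (g - h) = (cotensorFunctor f).map g - (cotensorFunctor f).map h :=
  RComod.hom_ext <| LinearMap.ext fun x => incl_injective Y.ρ (lamf f) <|
    LinearMap.congr_fun (LinearMap.rTensor_sub g.lin h.lin) (incl X.ρ (lamf f) x)

theorem preservesColimit_parallelPair_of_isCoflat (hf : (leftComodOf f).IsCoflat)
    {X Y : RComod k D} (g h : X ⟶ Y) :
    PreservesColimit (parallelPair g h) (cotensorFunctor f) := by
  let p : Y ⟶ RComod.coeq g h := RComod.coeqπ g h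
  have hp : Function.Surjective p.lin := RComod.coeqπ_surjective g h
  have he : Function.Exact (g - h).lin p.lin := RComod.coeqπ_exact g h
  have map_surjective : Function.Surjective ((cotensorFunctor f).map p).lin := hf.surjective p hp
  have map_exact : Function.Exact ((cotensorFunctor f).map (g - h)).lin
      ((cotensorFunctor f).map p).lin := hf.exact (g - h) p he hp
  rw [cotensorFunctor_map_sub] at map_exact
  exact preservesColimit_of_preserves_colimit_cocone (RComod.isColimitCofork he hp)
    ((isColimitMapCoconeCoforkEquiv _ (RComod.comp_eq_comp_of_exact he)).symm
      (RComod.isColimitCofork map_exact map_surjective))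

theorem comparison_isEquivalence_of_leftFaithfullyCoflat (hf : LeftFaithfullyCoflat f) :
    (Monad.comparison (corestAdj f)).IsEquivalence :=
  have := hf.2
  have : (cotensorFunctor f).Faithful := ⟨fun {_ _ _ _} e =>
    (cotVec (leftComodOf f)).map_injective
      (ModuleCat.hom_ext (congrArg RComod.Hom.lin e))⟩
  have : Monad.PreservesColimitOfIsReflexivePair (cotensorFunctor f) := ⟨fun _ _ g h _ =>
    preservesColimit_parallelPair_of_isCoflat hf.1 g h⟩
  (Monad.monadicOfHasPreservesReflexiveCoequalizersOfReflectsIsomorphisms (corestAdj f)).eqv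

variable (f)

section Expand

variable {V V' : Type v} [AddCommGroup V] [Module k V] [AddCommGroup V'] [Module k V']
  {ρ : V →ₗ[k] V ⊗[k] C} {ρ' : V' →ₗ[k] V' ⊗[k] C}

theorem incl_contract (y : Cotensor ρ (selfL f)) :
    incl _ _ (contract f ρ y) =
      (lEps C ∘ₗ incl (rhof f) (lamf f)).lTensor V (incl ρ (selfL f) y) := rfl

theorem lTensor_lEps_assoc (z : (V ⊗[k] C) ⊗[k] C) :
    (lEps C).lTensor V (TensorProduct.assoc k V C C z) = (rEps V).rTensor C z := by
  refine LinearMap.congr_fun (f := (lEps C).lTensor V ∘ₗ (TensorProduct.assoc k V C C).toLinearMap)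
    (TensorProduct.ext_threefold fun v c c' => ?_) z
  simp [smul_tmul]

theorem contract_expand (hρ : IsRightCoaction ρ) (x : Cotensor (corestR f ρ) (lamf f)) :
    contract f ρ (expand f ρ hρ x) = x := by
  have counit_comp : rEps V ∘ₗ ρ = LinearMap.id := LinearMap.ext hρ.rEps
  apply incl_injective
  rw [incl_contract, LinearMap.lTensor_comp_apply, expand_spec, lTensor_lEps_assoc,
    ← LinearMap.rTensor_comp_apply, counit_comp, LinearMap.rTensor_id, LinearMap.id_apply]

theorem expand_natural (hρ : IsRightCoaction ρ) (hρ' : IsRightCoaction ρ') {g : V →ₗ[k] V'}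
    (hg : RColinear ρ ρ' g) (x : Cotensor (corestR f ρ) (lamf f)) :
    cotMap g LinearMap.id hg (LColinear.id _) (expand f ρ hρ x) =
      expand f ρ' hρ' (cotMap g LinearMap.id (hg.corestR f) (LColinear.id _) x) := by
  apply incl_injective
  apply lTensor_inj _ (incl_injective (rhof f) (lamf f))
  rw [expand_spec, coe_cotMap, coe_cotMap]
  change (incl (rhof f) (lamf f)).lTensor V' (g.rTensor _ _) =
    TensorProduct.assoc k _ _ _ (ρ'.rTensor C (g.rTensor C _))
  rw [← rl_comm, expand_spec, assoc_rTensor_rTensor hg]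

theorem cotAct_expand {W : Type v} [AddCommGroup W] [Module k W] {ρ : W →ₗ[k] W ⊗[k] D}
    (hρ : IsRightCoaction (cotC f ρ)) (y : Cotensor (corestR f (cotC f ρ)) (lamf f)) :
    cotAct f ρ (expand f (cotC f ρ) hρ y) =
      cotMap (cotEps f ρ) LinearMap.id (cotEps_rColinear f) (LColinear.id _) y := by
  apply incl_injective
  rw [cotAct_spec, coe_cotMap, ← LinearMap.rTensor_comp_lTensor, LinearMap.comp_apply,
    ← incl_contract, contract_expand]
  rfl

theorem counit_lEps (z : C ⊗[k] C) :
    Coalgebra.counit (R := k) (lEps C z) = Coalgebra.counit (R := k) (rEps C z) := by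
  induction z with
  | zero => simp
  | add a b ha hb => simp only [map_add, ha, hb]
  | tmul a b => simp [mul_comm]

theorem incl_contract_cotMap_cotAct_cotAssoc
    (x : Cotensor (cotR ρ (selfL f) (cotC f (rhof f)) (self_commutes f)) (selfL f)) :
    incl _ _ (contract f ρ (cotMap LinearMap.id (cotAct f (rhof f)) (RColinear.id ρ)
        (cotAct_lColinear f (rhof f) Coalgebra.comul (rhof_commutes f))
        (cotAssoc ρ (selfL f) (cotC f (rhof f)) (self_commutes f) (selfL f) x))) =
      TensorProduct.map (cotEps f (corestR f ρ) ∘ₗ contract f ρ)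
        (lEps C ∘ₗ incl (rhof f) (lamf f)) (incl _ _ x) := by
  let r : Cotensor (rhof f) (lamf f) →ₗ[k] C := rEps C ∘ₗ incl (rhof f) (lamf f)
  let l : Cotensor (rhof f) (lamf f) →ₗ[k] C := lEps C ∘ₗ incl (rhof f) (lamf f)
  have incl_cotAct : incl (rhof f) (lamf f) ∘ₗ cotAct f (rhof f) =
      TensorProduct.map r l ∘ₗ incl (cotC f (rhof f)) (selfL f) := rfl
  rw [incl_contract, coe_cotMap]
  change (lEps C ∘ₗ incl (rhof f) (lamf f)).lTensor V ((cotAct f (rhof f)).lTensor V _) = _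
  rw [← LinearMap.lTensor_comp_apply, LinearMap.comp_assoc, incl_cotAct, ← LinearMap.comp_assoc,
    LinearMap.lTensor_comp_apply, cotAssoc_spec]
  induction incl (cotR ρ (selfL f) (cotC f (rhof f)) (self_commutes f)) (selfL f) x with
  | zero => simp
  | add a b ha hb => simp only [map_add, ha, hb]
  | tmul y q =>
    rw [LinearMap.rTensor_tmul, TensorProduct.map_tmul, LinearMap.comp_apply,
      LinearMap.comp_apply, incl_contract]
    induction incl ρ (selfL f) y with
    | zero => simp
    | add a b ha hb => simp only [map_add, add_tmul, ha, hb]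
    | tmul v p => simp [r, l, counit_lEps, smul_tmul]

end Expand

theorem cotC_isRightCoaction {W : Type v} [AddCommGroup W] [Module k W] (ρ : W →ₗ[k] W ⊗[k] D) :
    IsRightCoaction (cotC f ρ) :=
  cotR_isRightCoaction _ _ _ _ comul_isRightCoaction

theorem actD_unitMap (N : RMod (selfAlg f)) (n : N.V.carrier) :
    actD f N (unitMap f N.V.ρ N.V.isCo n) = n := by
  have expand_unitMap : expand f N.V.ρ N.V.isCo (unitMap f N.V.ρ N.V.isCo n) =
      cotMap LinearMap.id (selfUnit f) (RColinear.id _) (selfUnit_lColinear f)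
        (toCot N.V.ρ N.V.isCo n) := by
    apply incl_injective
    apply lTensor_inj _ (incl_injective (rhof f) (lamf f))
    rw [expand_spec, unitMap_spec, N.V.isCo.coassoc, coe_cotMap]
    change _ = (incl (rhof f) (lamf f)).lTensor _ ((selfUnit f).lTensor _ (N.V.ρ n))
    rw [← LinearMap.lTensor_comp_apply]
    rfl
  calc actD f N (unitMap f N.V.ρ N.V.isCo n)
      = N.act (cotMap LinearMap.id (selfUnit f) (RColinear.id _) (selfUnit_lColinear f)
          (toCot N.V.ρ N.V.isCo n)) := congrArg N.act expand_unitMap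
    _ = n := (N.act_one _).trans (N.V.isCo.rEps n)

theorem cotMap_cotAct_cotAssoc_expand {V : Type v} [AddCommGroup V] [Module k V]
    {ρ : V →ₗ[k] V ⊗[k] C} (hρ : IsRightCoaction ρ)
    (w : Cotensor (corestR f (cotC f (corestR f ρ))) (lamf f)) :
    cotMap LinearMap.id (cotAct f (rhof f)) (RColinear.id ρ)
        (cotAct_lColinear f (rhof f) Coalgebra.comul (rhof_commutes f))
        (cotAssoc ρ (selfL f) (cotC f (rhof f)) (self_commutes f) (selfL f)
          (expand f _ (cotR_isRightCoaction ρ _ _ _ (cotC_isRightCoaction f (rhof f)))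
            (cotMap (expand f ρ hρ) LinearMap.id ((expand_rColinear f ρ hρ).corestR f)
              (LColinear.id _) w))) =
      expand f ρ hρ
        (cotMap (cotEps f (corestR f ρ)) LinearMap.id (cotEps_rColinear f) (LColinear.id _) w) := by
  have contract_comp_expand : contract f ρ ∘ₗ expand f ρ hρ = LinearMap.id :=
    LinearMap.ext (contract_expand f hρ)
  rw [← expand_contract f ρ hρ (cotMap _ _ _ _ _)]
  apply congrArg (expand f ρ hρ)
  apply incl_injective
  rw [incl_contract_cotMap_cotAct_cotAssoc, ← LinearMap.rTensor_comp_lTensor, LinearMap.comp_apply,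
    ← incl_contract, contract_expand, coe_cotMap, coe_cotMap]
  change LinearMap.rTensor C _ (LinearMap.rTensor C _ _) = LinearMap.rTensor C _ _
  rw [← LinearMap.rTensor_comp_apply, LinearMap.comp_assoc, contract_comp_expand,
    LinearMap.comp_id]

theorem actD_assoc (N : RMod (selfAlg f))
    (w : Cotensor (corestR f (cotC f (corestR f N.V.ρ))) (lamf f)) :
    actD f N (cotMap (actD f N) LinearMap.id ((actD_rColinear f N).corestR f)
        (LColinear.id _) w) =
      actD f N (cotMap (epsD f N) LinearMap.id (epsD_rColinear f N) (LColinear.id _) w) := by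
  have hρ : IsRightCoaction (cotR N.V.ρ (selfL f) (cotC f (rhof f)) (self_commutes f)) :=
    cotR_isRightCoaction _ _ _ _ (cotC_isRightCoaction f (rhof f))
  have expand_colin := (expand_rColinear f N.V.ρ N.V.isCo).corestR f
  let z := cotMap (expand f N.V.ρ N.V.isCo) LinearMap.id expand_colin (LColinear.id _) w
  calc actD f N (cotMap (actD f N) LinearMap.id ((actD_rColinear f N).corestR f) _ w)
      = N.act (expand f N.V.ρ N.V.isCo
          (cotMap N.act LinearMap.id (N.act_colin.corestR f) (LColinear.id _) z)) :=
        congrArg (actD f N) (cotMap_comp (N.act_colin.corestR f) expand_colin w)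
    _ = N.act (cotMap N.act LinearMap.id N.act_colin (LColinear.id _) (expand f _ hρ z)) :=
        congrArg N.act (expand_natural f hρ N.V.isCo N.act_colin z).symm
    _ = _ := N.act_assoc (expand f _ hρ z)
    _ = actD f N (cotMap (epsD f N) LinearMap.id (epsD_rColinear f N) (LColinear.id _) w) :=
        congrArg N.act (cotMap_cotAct_cotAssoc_expand f N.V.isCo w)

/-- A `C □_D C`-module is an algebra for the monad of `corestAdj f`, through the action
`N □_D C → N`. -/
def toAlgebra : RMod (selfAlg f) ⥤ (corestAdj f).toMonad.Algebra where
  obj N :=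
    { A := N.V
      a := ⟨actD f N, actD_rColinear f N⟩
      unit := RComod.hom_ext (LinearMap.ext (actD_unitMap f N))
      assoc := RComod.hom_ext (LinearMap.ext fun w => (actD_assoc f N w).symm) }
  map g := ⟨g.hom, RComod.hom_ext (LinearMap.ext fun y => (actD_natural f g y).symm)⟩

instance : (toAlgebra f).Faithful where
  map_injective h := RMod.hom_ext
    (congrArg (fun g : Monad.Algebra.Hom _ _ => RComod.Hom.lin g.f) h)

instance : (toAlgebra f).Full where
  map_surjective {M N} g := by
    let h : M.V ⟶ N.V := g.f
    have h_actD (y : Cotensor (corestR f M.V.ρ) (lamf f)) : h.lin (actD f M y) =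
        actD f N (cotMap h.lin LinearMap.id (h.colin.corestR f) (LColinear.id _) y) :=
      (LinearMap.congr_fun (congrArg RComod.Hom.lin g.h) y).symm
    refine ⟨⟨h, fun x => ?_⟩, rfl⟩
    obtain ⟨y, rfl⟩ : ∃ y, expand f M.V.ρ M.V.isCo y = x := ⟨_, expand_contract f _ M.V.isCo x⟩
    exact (h_actD y).trans (congrArg N.act (expand_natural f M.V.isCo N.V.isCo h.colin y).symm)

theorem toAlgebra_cotFunctor_a (W : RComod k D) :
    ((toAlgebra f).obj ((cotFunctor f).obj W)).a =
      (cotensorFunctor f).map ((corestAdj f).counit.app W) :=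
  RComod.hom_ext (LinearMap.ext (cotAct_expand f (cotC_isRightCoaction f W.ρ)))

/-- Under `toAlgebra f`, the functor `- □_D C` to `C □_D C`-modules becomes the comparison functor
of `corestAdj f`. -/
def cotFunctorCompToAlgebra :
    cotFunctor f ⋙ toAlgebra f ≅ Monad.comparison (corestAdj f) :=
  NatIso.ofComponents
    (fun W => Monad.Algebra.isoMk (Iso.refl ((cotensorFunctor f).obj W)) (by
      have id_isHom {T : Monad (RComod k C)} {X : RComod k C} {a b : T.obj X ⟶ X} (h : a = b) :
          T.map (𝟙 X) ≫ b = a ≫ 𝟙 X := by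
        rw [T.map_id, Category.id_comp, Category.comp_id, h]
      exact id_isHom (toAlgebra_cotFunctor_a f W)))
    (fun g => Monad.Algebra.Hom.ext ((Category.comp_id ((cotensorFunctor f).map g)).trans
      (Category.id_comp ((cotensorFunctor f).map g)).symm))

theorem cotFunctor_isEquivalence [(Monad.comparison (corestAdj f)).IsEquivalence] :
    (cotFunctor f).IsEquivalence := by
  have : (cotFunctor f ⋙ toAlgebra f).IsEquivalence :=
    Functor.isEquivalence_of_iso (cotFunctorCompToAlgebra f).symm
  have : (toAlgebra f).EssSurj := ⟨fun A =>
    ⟨_, ⟨(cotFunctor f ⋙ toAlgebra f).objObjPreimageIso A⟩⟩⟩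
  have : (toAlgebra f).IsEquivalence := {}
  exact Functor.isEquivalence_of_comp_right (cotFunctor f) (toAlgebra f)

variable {f}

section Split

variable {V W : Type v} [AddCommGroup V] [Module k V] [AddCommGroup W] [Module k W]
  {ρ : V →ₗ[k] V ⊗[k] D} {ρ' : W →ₗ[k] W ⊗[k] D} {s : D →ₗ[k] C}

theorem rTensor_incl_corestR_cotC (y : Cotensor ρ (lamf f)) :
    (incl ρ (lamf f)).rTensor D (corestR f (cotC f ρ) y) =
      (TensorProduct.assoc k V C D).symm ((rhof f).lTensor V (incl ρ (lamf f) y)) := by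
  rw [corestR, LinearMap.comp_apply, rl_comm, cotR_spec, rhof, corestR,
    LinearMap.lTensor_comp_apply, LinearMap.lTensor_tensor]
  simp

variable (hl : LColinear Coalgebra.comul (lamf f) s)

/-- The map `V ≅ V □_D D → V □_D C` induced by a left colinear map `s : D → C`. -/
def cotSection (hρ : IsRightCoaction ρ) : V →ₗ[k] Cotensor ρ (lamf f) :=
  cotMap LinearMap.id s (RColinear.id ρ) hl ∘ₗ toCot ρ hρ

theorem incl_cotSection (hρ : IsRightCoaction ρ) (x : V) :
    incl ρ (lamf f) (cotSection hl hρ x) = s.lTensor V (ρ x) := rfl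

theorem cotSection_natural (hρ : IsRightCoaction ρ) (hρ' : IsRightCoaction ρ') {g : V →ₗ[k] W}
    (hg : RColinear ρ ρ' g) (x : V) : cotSection hl hρ' (g x) =
      cotMap g LinearMap.id hg (LColinear.id _) (cotSection hl hρ x) := by
  apply incl_injective
  rw [incl_cotSection, hg, ← rl_comm]
  rfl

theorem cotSection_rColinear (hr : RColinear Coalgebra.comul (rhof f) s)
    (hρ : IsRightCoaction ρ) : RColinear ρ (corestR f (cotC f ρ)) (cotSection hl hρ) := by
  have hr' : rhof f ∘ₗ s = s.rTensor D ∘ₗ Coalgebra.comul := LinearMap.ext hr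
  intro x
  apply rTensor_inj _ (incl_injective ρ (lamf f))
  rw [rTensor_incl_corestR_cotC, incl_cotSection, ← LinearMap.lTensor_comp_apply, hr',
    LinearMap.lTensor_comp_apply, ← hρ.coassoc, ← LinearMap.rTensor_comp_apply]
  refine (TensorProduct.map_map_assoc_symm ..).symm.trans ?_
  rw [LinearEquiv.symm_apply_apply]
  exact (LinearMap.rTensor_comp_apply D (s.lTensor V) ρ (ρ x)).symm

theorem cotEps_cotSection (hs : (f : C →ₗ[k] D) ∘ₗ s = LinearMap.id) (hρ : IsRightCoaction ρ)
    (x : V) : cotEps f ρ (cotSection hl hρ x) = x := by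
  have counit_comp : Coalgebra.counit (R := k) (A := C) ∘ₗ s = Coalgebra.counit := by
    rw [← f.counit_comp, LinearMap.comp_assoc]
    exact (congrArg _ hs).trans (LinearMap.comp_id _)
  rw [LinearMap.comp_apply, incl_cotSection, rEps, LinearMap.comp_apply,
    ← LinearMap.lTensor_comp_apply, counit_comp]
  exact hρ.rEps x

/-- The natural transformation with components `W ≅ W □_D D → W □_D C` induced by a bicolinear map
`s : D → C`. -/
def cotSectionTrans (hr : RColinear Coalgebra.comul (rhof f) s) :
    𝟭 (RComod k D) ⟶ cotensorFunctor f ⋙ corestrict f where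
  app W := ⟨cotSection hl W.isCo, cotSection_rColinear hl hr W.isCo⟩
  naturality V W g := RComod.hom_ext (LinearMap.ext (cotSection_natural hl V.isCo W.isCo g.colin))

end Split

theorem comparison_isEquivalence_of_splitsInBicomodules (hf : SplitsInBicomodules f) :
    (Monad.comparison (corestAdj f)).IsEquivalence := by
  obtain ⟨s, hl, hr, hs⟩ := hf
  have : Monad.HasCoequalizerOfIsSplitPair (cotensorFunctor f) := ⟨fun _ _ _ => inferInstance⟩
  refine comparison_isEquivalence_of_counit_section (corestAdj f) (σ := cotSectionTrans hl hr) ?_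
  ext W : 2
  exact RComod.hom_ext (LinearMap.ext (cotEps_cotSection hl hs W.isCo))

end

end CoalgDescent

theorem mainTheorem10 {k : Type u} [Field k] {C D : Type v}
    [AddCommGroup C] [Module k C] [Coalgebra k C]
    [AddCommGroup D] [Module k D] [Coalgebra k D] (f : C →ₗc[k] D)
    (hf : CoalgDescent.LeftFaithfullyCoflat f ∨ CoalgDescent.SplitsInBicomodules f) :
    IsIso (CoalgDescent.descentAdj f).unit ∧ IsIso (CoalgDescent.descentAdj f).counit := by
  have : (Monad.comparison (CoalgDescent.corestAdj f)).IsEquivalence := hf.elim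
    CoalgDescent.comparison_isEquivalence_of_leftFaithfullyCoflat
    CoalgDescent.comparison_isEquivalence_of_splitsInBicomodules
  have := CoalgDescent.cotFunctor_isEquivalence f
  exact ⟨inferInstance, inferInstance⟩
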